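/- Notation: $B(x,r)$ is the open ball in $\mathbb{R}^n$ (empty if $r\le 0$) and $d_H$ is the Hausdorff distance. For $k\in\mathbb{N}$ and $\varepsilon,R>0$, a compact connected (nonempty) set $X\subseteq\mathbb{R}^n$ is called $k$-dimensional $(\varepsilon,R)$ Reifenberg flat if for every $x\in X$ and every $0<r<R$ there is a $k$-dimensional affine plane $P_{x,r}$ through $x$ with $d_H(B(x,r)\cap P_{x,r},\,B(x,r)\cap X)\le\varepsilon r$. **Corollary 2.5.** Let $n,k\in\mathbb{N}$. For every $\delta>0$ there exists $\varepsilon>0$ such that if $R>0$ and $X\subseteq\mathbb{R}^n$ is a $k$-dimensional $(\varepsilon,R)$ Reifenberg flat set, then for every $0<r<R/10$ there exists a compact smooth embedded $k$-dimensional submanifold without boundary $X^r\subseteq\mathbb{R}^n$ such that 1. $d_H(X,X^r)\le\delta r$; 2. the second fundamental form $A^r$ of $X^r$ satisfies $|A^r|\le\delta/r$ at every point of $X^r$, where $|A|^2=\sum_{i,j}|A(e_i,e_j)|^2$ for an orthonormal basis $(e_i)$ of the tangent space; 3. for every $x\in X$, one can write $X^r\cap B(x,r)=G\cup B$ with $G$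 connected (and nonempty) and $B\subseteq B(x,r)\setminus B(x,(1-\delta)r)$; 4. for every $x\in X$ and every $s\in(r,R/10)$, one can write $X^r\cap B(x,s)=G\cup B$ with $G$ connected (and nonempty) and $B\subseteq B(x,s)\setminus B(x,(1-5\delta)s)$. -/

import Mathlib

open scoped ContDiff InnerProductSpace

noncomputable section

/-- A compact connected (in particular nonempty) set `X ⊆ ℝⁿ` is `k`-dimensional `(ε, R)`
Reifenberg flat: for every `x ∈ X` and every scale `0 < r < R` there is a `k`-dimensional affine
plane `P` through `x` with `d_H(B(x,r) ∩ P, B(x,r) ∩ X) ≤ ε r`. -/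
def IsReifenbergFlat {n : ℕ} (k : ℕ) (ε R : ℝ) (X : Set (EuclideanSpace ℝ (Fin n))) : Prop :=
  IsCompact X ∧ IsConnected X ∧
    ∀ x ∈ X, ∀ r : ℝ, 0 < r → r < R →
      ∃ P : AffineSubspace ℝ (EuclideanSpace ℝ (Fin n)),
        x ∈ P ∧ Module.finrank ℝ P.direction = k ∧
        Metric.hausdorffEDist (Metric.ball x r ∩ (P : Set (EuclideanSpace ℝ (Fin n))))
          (Metric.ball x r ∩ X) ≤ ENNReal.ofReal (ε * r)

/-- `φ : U → ℝⁿ` is a smooth local parametrization of `M`, defined on an open set `U ⊆ ℝᵏ`: a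
smooth immersion which is a homeomorphism onto a relatively open subset of `M`. -/
structure IsLocalParametrization {k n : ℕ} (M : Set (EuclideanSpace ℝ (Fin n)))
    (U : Set (EuclideanSpace ℝ (Fin k)))
    (φ : EuclideanSpace ℝ (Fin k) → EuclideanSpace ℝ (Fin n)) : Prop where
  isOpen_source : IsOpen U
  contDiffOn : ContDiffOn ℝ ∞ φ U
  injective_fderiv : ∀ u ∈ U, Function.Injective (fderiv ℝ φ u)
  isEmbedding : Topology.IsEmbedding (U.domRestrict φ)
  relOpen_image : ∃ V : Set (EuclideanSpace ℝ (Fin n)), IsOpen V ∧ φ '' U = M ∩ V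

/-- `M` is a smooth embedded `k`-dimensional submanifold (without boundary) of `ℝⁿ`. -/
def IsSmoothSubmanifold {n : ℕ} (k : ℕ) (M : Set (EuclideanSpace ℝ (Fin n))) : Prop :=
  ∀ p ∈ M, ∃ (U : Set (EuclideanSpace ℝ (Fin k)))
    (φ : EuclideanSpace ℝ (Fin k) → EuclideanSpace ℝ (Fin n)),
    IsLocalParametrization M U φ ∧ p ∈ φ '' U

/-- The coordinate vector field `∂ⱼφ`. -/
def coordDeriv {k n : ℕ} (φ : EuclideanSpace ℝ (Fin k) → EuclideanSpace ℝ (Fin n)) (j : Fin k)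
    (u : EuclideanSpace ℝ (Fin k)) : EuclideanSpace ℝ (Fin n) :=
  fderiv ℝ φ u (EuclideanSpace.single j 1)

/-- The matrix `gᵢⱼ = ⟨∂ᵢφ, ∂ⱼφ⟩` of the induced metric. -/
def metricMatrix {k n : ℕ} (φ : EuclideanSpace ℝ (Fin k) → EuclideanSpace ℝ (Fin n))
    (u : EuclideanSpace ℝ (Fin k)) : Matrix (Fin k) (Fin k) ℝ :=
  Matrix.of fun i j => ⟪coordDeriv φ i u, coordDeriv φ j u⟫_ℝ

/-- The coefficient `Aᵢⱼ = (∂ᵢ∂ⱼφ)^⊥` of the second fundamental form, where `⊥` is the orthogonal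
projection to the normal space, the orthogonal complement of the tangent space `im Dφ(u)`. -/
def secondFundamentalForm {k n : ℕ} (φ : EuclideanSpace ℝ (Fin k) → EuclideanSpace ℝ (Fin n))
    (u : EuclideanSpace ℝ (Fin k)) (i j : Fin k) : EuclideanSpace ℝ (Fin n) :=
  ((fderiv ℝ φ u).range)ᗮ.starProjection (coordDeriv (coordDeriv φ j) i u)

/-- The norm of the second fundamental form, `|A|² = gⁱᵖ gʲq ⟨Aᵢⱼ, A_pq⟩`, at the point `φ u`. -/
def secondFundamentalFormNorm {k n : ℕ}
    (φ : EuclideanSpace ℝ (Fin k) → EuclideanSpace ℝ (Fin n))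
    (u : EuclideanSpace ℝ (Fin k)) : ℝ :=
  √(∑ i, ∑ j, ∑ p, ∑ q, (metricMatrix φ u)⁻¹ i p * (metricMatrix φ u)⁻¹ j q *
    ⟪secondFundamentalForm φ u i j, secondFundamentalForm φ u p q⟫_ℝ)

/-- `|A| ≤ c` at every point of the `k`-dimensional submanifold `M`. As `|A|` does not depend on
the parametrization, it is computed in any local parametrization. -/
def SecondFundamentalFormBound {n : ℕ} (k : ℕ) (M : Set (EuclideanSpace ℝ (Fin n))) (c : ℝ) :
    Prop :=
  ∀ (U : Set (EuclideanSpace ℝ (Fin k)))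
    (φ : EuclideanSpace ℝ (Fin k) → EuclideanSpace ℝ (Fin n)),
    IsLocalParametrization M U φ → ∀ u ∈ U, secondFundamentalFormNorm φ u ≤ c

/-- `M ∩ B(x,s)` is the union of a connected set `G` and a set `B` contained in the annulus
`B(x,s) \ B(x,ρ)`. -/
def ConnectedUpToAnnulus {n : ℕ} (M : Set (EuclideanSpace ℝ (Fin n)))
    (x : EuclideanSpace ℝ (Fin n)) (s ρ : ℝ) : Prop :=
  ∃ G B : Set (EuclideanSpace ℝ (Fin n)),
    M ∩ Metric.ball x s = G ∪ B ∧ IsConnected G ∧ B ⊆ Metric.ball x s \ Metric.ball x ρ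

end

noncomputable section

open Metric Set Filter Topology

/-! Take a `ρ`-net of `X`, with `ρ` a small multiple of `r`, and let each net point carry the
orthogonal projection onto the normal space of its approximating plane. A smooth weighted average of
these projections is almost idempotent; a smooth retraction turns it into an honest idempotent `T
x`. The average of the vectors `pᵢ (x - yᵢ)`, projected to the range of `T x`, is the field
`normalField`, and `M` is its zero set near `X`. Projecting to the range of `T x` makes the zero set
have the right dimension: near `x₀`, vanishing of the field is equivalent to vanishing of its
component along the normal space of the single plane at `x₀`.

If all planes coincide, the field is exactly the normal projection, relative to a base point on the
plane, and `M` is the plane. The estimates for almost flat data come from compactness rather than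
explicit computation (`exists_almost_flat`): after rescaling to `ρ = 1` and bounding the number of
relevant net points, exactly flat configurations form a compact set, on which the error and its
first two derivatives vanish; by continuity they stay small nearby. Hence around every point of `X`,
`M` is the preimage of a linear subspace under a map `C²`-close to a translation
(`IsAlmostFlatChart`, `exists_almostFlatCharts`).

Such charts yield the smooth structure by the inverse function theorem, the Hausdorff bound
directly, and the curvature bound by differentiating the defining equation twice. For connectedness,
flatness of `X` joins points by chains with steps below `ρ / 8` (`IsApproxFlat.hasChain`), and the
connected chart pieces of `M` at consecutive chain points meet, so they lie in one component. -/

/-! ### Smooth retraction onto idempotents of a Banach algebra -/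

/-- A smooth square root near the unit of a Banach algebra. -/
theorem exists_smooth_sqrt_near_one (𝔸 : Type*) [NormedRing 𝔸] [NormedAlgebra ℝ 𝔸]
    [CompleteSpace 𝔸] :
    ∃ b : 𝔸 → 𝔸, b 1 = 1 ∧ ∀ᶠ t in 𝓝 (1 : 𝔸), ContDiffAt ℝ ω b t ∧ b t * b t = t := by
  let f : 𝔸 → 𝔸 := fun x => x * x
  have hf : ContDiff ℝ ω f := contDiff_id.mul contDiff_id
  -- The derivative of squaring at `1` is multiplication by `2`, so the inverse function theorem
  -- applies.
  let f' : 𝔸 ≃L[ℝ] 𝔸 := ContinuousLinearEquiv.smulLeft (Units.mk0 (2 : ℝ) two_ne_zero)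
  have hf' : HasFDerivAt f (f' : 𝔸 →L[ℝ] 𝔸) 1 := by
    have h := (hasFDerivAt_id (𝕜 := ℝ) (1 : 𝔸)).mul' (hasFDerivAt_id (𝕜 := ℝ) (1 : 𝔸))
    refine h.congr_fderiv ?_
    ext x
    simp only [f', id, add_apply,
      ContinuousLinearMap.id_apply, MulOpposite.op_one, one_smul,
      ContinuousLinearEquiv.coe_coe]
    exact (two_smul ℝ x).symm
  have hs : HasStrictFDerivAt f (f' : 𝔸 →L[ℝ] 𝔸) 1 :=
    hf.contDiffAt.hasStrictFDerivAt' hf' (by simp)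
  have h1 : f 1 = 1 := by simp [f]
  have hω : (ω : WithTop ℕ∞) ≠ 0 := by simp
  refine ⟨(hf.contDiffAt (x := 1)).localInverse hf' hω, ?_, ?_⟩
  · have := hs.localInverse_apply_image
    rwa [h1] at this
  · have hc := (hf.contDiffAt (x := (1 : 𝔸))).to_localInverse hf' hω
    have hr := hs.eventually_right_inverse
    rw [h1] at hc hr
    filter_upwards [hc.eventually (by simp), hr] with t ht1 ht2 using ⟨ht1, ht2⟩

/-- Near the set of idempotents of a Banach algebra there is a smooth retraction onto it. -/
theorem exists_idempotent_retraction (𝔸 : Type*) [NormedRing 𝔸] [NormedAlgebra ℝ 𝔸]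
    [CompleteSpace 𝔸] :
    ∃ (F : 𝔸 → 𝔸) (V : Set 𝔸), IsOpen V ∧ (∀ q, q * q = q → q ∈ V ∧ F q = q) ∧
      ∀ a ∈ V, ContDiffAt ℝ ∞ F a ∧ F a * F a = F a := by
  obtain ⟨b, hb1, hb⟩ := exists_smooth_sqrt_near_one 𝔸
  have hinv1 : Ring.inverse (1 : 𝔸) = 1 := Ring.inverse_one 𝔸
  have hci : ContDiffAt ℝ ω (Ring.inverse : 𝔸 → 𝔸) 1 := by
    simpa using contDiffAt_ringInverse ℝ (n := ω) (1 : 𝔸ˣ)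
  have hbc : ContDiffAt ℝ ω b (Ring.inverse 1) := by
    rw [hinv1]; exact hb.self_of_nhds.1
  let c : 𝔸 → 𝔸 := fun t => b (Ring.inverse t)
  have hc1 : c 1 = 1 := by simp [c, hb1]
  have hcs : ContDiffAt ℝ ω c 1 := hbc.comp _ hci
  have hev : ∀ᶠ t in 𝓝 (1 : 𝔸), ContDiffAt ℝ ω c t ∧ c t * c t = Ring.inverse t ∧ IsUnit t ∧
      ‖c t - 1‖ < 1 / 2 := by
    have e1 : ∀ᶠ t in 𝓝 (1 : 𝔸), c t * c t = Ring.inverse t := by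
      have : Tendsto (Ring.inverse : 𝔸 → 𝔸) (𝓝 1) (𝓝 1) := by
        have := hci.continuousAt.tendsto
        rwa [hinv1] at this
      exact (this.eventually hb).mono fun t ht => ht.2
    have e2 : ∀ᶠ t in 𝓝 (1 : 𝔸), ‖c t - 1‖ < 1 / 2 := by
      have : ContinuousAt (fun t => ‖c t - 1‖) 1 :=
        (hcs.continuousAt.sub continuousAt_const).norm
      refine this.eventually_lt continuousAt_const ?_
      simp [hc1]
    have e3 : ∀ᶠ t in 𝓝 (1 : 𝔸), IsUnit t := Units.isOpen.mem_nhds isUnit_one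
    filter_upwards [hcs.eventually (by simp), e1, e2, e3] with t h1 h2 h3 h4
      using ⟨h1, h2, h4, h3⟩
  obtain ⟨V, hV, hVo, h1V⟩ := _root_.eventually_nhds_iff.1 hev
  let S : 𝔸 → 𝔸 := fun a => (2 : ℝ) • a - 1
  have hS : ContDiff ℝ ω S := (contDiff_id.const_smul (2 : ℝ)).sub contDiff_const
  -- An element `a` is idempotent iff `S a = 2a - 1` squares to `1`. Here `c t` plays the role of
  -- `t^(-1/2)`, so `S a * c (S a * S a)` is the normalized involution.
  let F : 𝔸 → 𝔸 := fun a => (1 / 2 : ℝ) • (1 + S a * c (S a * S a))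
  have hF : ∀ a, F a = (1 / 2 : ℝ) • (1 + S a * c (S a * S a)) := fun a => rfl
  refine ⟨F, (fun a => S a * S a) ⁻¹' V,
    hVo.preimage (hS.continuous.mul hS.continuous), ?_, ?_⟩
  · intro q hq
    have hSq : S q * S q = 1 := by
      simp only [S, sub_mul, mul_sub, smul_mul_assoc, mul_smul_comm, hq, one_mul, mul_one]
      module
    refine ⟨by simpa [hSq] using h1V, ?_⟩
    simp only [hF, hSq, hc1, mul_one]
    simp only [S]
    module
  · intro a ha
    obtain ⟨hs, hsq, hu, hn⟩ := hV _ ha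
    refine ⟨?_, ?_⟩
    · have hSS : ContDiffAt ℝ ω (fun a => S a * S a) a := (hS.mul hS).contDiffAt
      have : ContDiffAt ℝ ω F a :=
        (contDiffAt_const.add (hS.contDiffAt.mul (hs.comp a hSS))).const_smul (1 / 2 : ℝ)
      exact this.of_le (by simp)
    · set s := S a with hs'
      set d := c (s * s) with hd
      -- The root comes from the inverse function theorem, so it is not visibly a function of `s *
      -- s` commuting with `s`. Only `d * d`, the inverse of `s * s`, clearly commutes with `s`.
      have hcomm2 : s * (d * d) = (d * d) * s := by
        rw [hsq]
        have h1 : Commute s (s * s) := (Commute.refl s).mul_right (Commute.refl s)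
        rw [Ring.inverse_of_isUnit hu]
        exact (Commute.units_inv_right (u := hu.unit) h1).eq
      have hC0 : s * d - d * s = 0 := by
        set C := s * d - d * s with hC
        -- The commutator anticommutes with `d`; since `d` is within `1 / 2` of `1`, this forces it
        -- to vanish.
        have e : (2 : ℝ) • C = -((d - 1) * C + C * (d - 1)) := by
          have e0 : d * C + C * d = 0 := by
            have : d * C + C * d = s * (d * d) - (d * d) * s := by
              rw [hC]; noncomm_ring
            rw [this, hcomm2, sub_self]
          have : (d - 1) * C + C * (d - 1) = (d * C + C * d) - (2 : ℝ) • C := by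
            rw [two_smul]; noncomm_ring
          rw [this, e0]; simp
        have h2 : 2 * ‖C‖ ≤ ‖d - 1‖ * ‖C‖ + ‖C‖ * ‖d - 1‖ := by
          have := congrArg norm e
          rw [norm_smul, norm_neg] at this
          simp only [Real.norm_ofNat] at this
          rw [this]
          exact (norm_add_le _ _).trans (add_le_add (norm_mul_le _ _) (norm_mul_le _ _))
        have : ‖C‖ ≤ 0 := by nlinarith [norm_nonneg C]
        exact norm_le_zero_iff.1 this
      have hcomm : s * d = d * s := sub_eq_zero.1 hC0
      have hone : (s * d) * (s * d) = 1 := by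
        calc (s * d) * (s * d) = s * (d * s) * d := by noncomm_ring
          _ = (s * s) * (d * d) := by rw [← hcomm]; noncomm_ring
          _ = 1 := by rw [hsq]; exact Ring.mul_inverse_cancel _ hu
      rw [hF a]
      simp only [← hs', ← hd]
      simp only [smul_mul_assoc, mul_smul_comm, mul_add, add_mul, one_mul, mul_one, hone]
      module

/-! ### The averaged normal field and its stability near flat data -/

section NormalField

/-- A smooth retraction onto the idempotents of a Banach algebra, defined near them. -/
def idempotentRetraction (𝔸 : Type*) [NormedRing 𝔸] [NormedAlgebra ℝ 𝔸] [CompleteSpace 𝔸] :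
    𝔸 → 𝔸 :=
  (exists_idempotent_retraction 𝔸).choose

/-- The open set on which `idempotentRetraction` is a smooth retraction. -/
def idempotentRetractionDomain (𝔸 : Type*) [NormedRing 𝔸] [NormedAlgebra ℝ 𝔸]
    [CompleteSpace 𝔸] : Set 𝔸 :=
  (exists_idempotent_retraction 𝔸).choose_spec.choose

section Retraction

variable {𝔸 : Type*} [NormedRing 𝔸] [NormedAlgebra ℝ 𝔸] [CompleteSpace 𝔸]

theorem isOpen_idempotentRetractionDomain : IsOpen (idempotentRetractionDomain 𝔸) :=
  (exists_idempotent_retraction 𝔸).choose_spec.choose_spec.1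

theorem mem_idempotentRetractionDomain {q : 𝔸} (hq : q * q = q) :
    q ∈ idempotentRetractionDomain 𝔸 :=
  ((exists_idempotent_retraction 𝔸).choose_spec.choose_spec.2.1 q hq).1

theorem idempotentRetraction_of_idempotent {q : 𝔸} (hq : q * q = q) :
    idempotentRetraction 𝔸 q = q :=
  ((exists_idempotent_retraction 𝔸).choose_spec.choose_spec.2.1 q hq).2

theorem contDiffAt_idempotentRetraction {a : 𝔸} (ha : a ∈ idempotentRetractionDomain 𝔸) :
    ContDiffAt ℝ ∞ (idempotentRetraction 𝔸) a :=
  ((exists_idempotent_retraction 𝔸).choose_spec.choose_spec.2.2 a ha).1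

theorem idempotentRetraction_mul_self {a : 𝔸} (ha : a ∈ idempotentRetractionDomain 𝔸) :
    idempotentRetraction 𝔸 a * idempotentRetraction 𝔸 a = idempotentRetraction 𝔸 a :=
  ((exists_idempotent_retraction 𝔸).choose_spec.choose_spec.2.2 a ha).2

end Retraction

variable {E : Type*} [NormedAddCommGroup E] [InnerProductSpace ℝ E] [FiniteDimensional ℝ E]
variable {ι : Type*} [Fintype ι]

/-- A smooth cutoff function, equal to `1` on the ball of radius `4` and supported in the ball
of radius `8`. -/
def cutoff (E : Type*) [NormedAddCommGroup E] [InnerProductSpace ℝ E] [FiniteDimensional ℝ E] :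
    ContDiffBump (0 : E) :=
  ⟨4, 8, by norm_num, by norm_num⟩

theorem cutoff_contDiff : ContDiff ℝ ∞ (cutoff E) := (cutoff E).contDiff

theorem cutoff_eq_one {x : E} (hx : ‖x‖ ≤ 4) : cutoff E x = 1 :=
  (cutoff E).one_of_mem_closedBall (by simpa [cutoff] using hx)

theorem cutoff_eq_zero {x : E} (hx : 8 ≤ ‖x‖) : cutoff E x = 0 :=
  (cutoff E).zero_of_le_dist (by simpa [cutoff] using hx)

/-- The weighted sum `∑ cᵢ ψ(x - yᵢ) gᵢ`. -/
def weightedSum {F : Type*} [AddCommGroup F] [Module ℝ F] (c : ι → ℝ) (y : ι → E) (g : ι → F)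
    (x : E) : F :=
  ∑ i, (c i * cutoff E (x - y i)) • g i

/-- The total weight `∑ cᵢ ψ(x - yᵢ)`. -/
def totalWeight (c : ι → ℝ) (y : ι → E) (x : E) : ℝ :=
  weightedSum c y (fun _ => (1 : ℝ)) x

/-- The weighted average of the operators `pᵢ`. -/
def averageOperator (c : ι → ℝ) (y : ι → E) (p : ι → E →L[ℝ] E) (x : E) : E →L[ℝ] E :=
  (totalWeight c y x)⁻¹ • weightedSum c y p x

/-- The weighted average of the vectors `pᵢ (x - yᵢ)`. -/
def averageOffset (c : ι → ℝ) (y : ι → E) (p : ι → E →L[ℝ] E) (x : E) : E :=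
  (totalWeight c y x)⁻¹ • weightedSum c y (fun i => p i (x - y i)) x

/-- The averaged offset, projected to the range of the idempotent nearest to the averaged
operator. -/
def normalField (c : ι → ℝ) (y : ι → E) (p : ι → E →L[ℝ] E) (x : E) : E :=
  idempotentRetraction (E →L[ℝ] E) (averageOperator c y p x) (averageOffset c y p x)

section Flat

theorem weightedSum_sub_const {F : Type*} [AddCommGroup F] [Module ℝ F] (c : ι → ℝ) (y : ι → E)
    (g : ι → F) (x a : E) :
    weightedSum c (fun i => y i - a) g (x - a) = weightedSum c y g x := by
  simp [weightedSum]

theorem normalField_sub_const (c : ι → ℝ) (y : ι → E) (p : ι → E →L[ℝ] E) (x a : E) :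
    normalField c (fun i => y i - a) p (x - a) = normalField c y p x := by
  simp [normalField, averageOperator, averageOffset, totalWeight, weightedSum_sub_const]

theorem averageOperator_eq_of_flat {c : ι → ℝ} {y : ι → E} {p : ι → E →L[ℝ] E} {q : E →L[ℝ] E}
    (hp : ∀ i, p i = q) {x : E} (hx : totalWeight c y x ≠ 0) : averageOperator c y p x = q := by
  have : weightedSum c y p x = totalWeight c y x • q := by
    simp [weightedSum, totalWeight, Finset.sum_smul, hp]
  rw [averageOperator, this, smul_smul, inv_mul_cancel₀ hx, one_smul]

theorem normalField_eq_of_flat {c : ι → ℝ} {y : ι → E} {p : ι → E →L[ℝ] E} {q : E →L[ℝ] E}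
    (hp : ∀ i, p i = q) (hy : ∀ i, q (y i) = 0) (hq : q * q = q) {x : E}
    (hx : totalWeight c y x ≠ 0) : normalField c y p x = q x := by
  have : weightedSum c y (fun i => p i (x - y i)) x = totalWeight c y x • q x := by
    simp [weightedSum, totalWeight, Finset.sum_smul, hp, hy]
  rw [normalField, averageOperator_eq_of_flat hp hx, idempotentRetraction_of_idempotent hq,
    averageOffset, this, smul_smul, inv_mul_cancel₀ hx, one_smul]
  exact congrArg (fun f : E →L[ℝ] E => f x) hq

end Flat

/-- The space of parameters: weights, base points, operators, and a reference operator. -/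
abbrev FlatParam (ι E : Type*) [NormedAddCommGroup E] [InnerProductSpace ℝ E] : Type _ :=
  (ι → ℝ) × (ι → E) × (ι → E →L[ℝ] E) × (E →L[ℝ] E)

/-- The deviation of the reference component of `normalField` from that of the identity. -/
def normalError (z : E × FlatParam ι E) : E :=
  z.2.2.2.2 (normalField z.2.1 z.2.2.1 z.2.2.2.1 z.1 - z.1)

/-- The averaged operator as a function of the point and the parameters. -/
def jointOperator (z : E × FlatParam ι E) : E →L[ℝ] E :=
  averageOperator z.2.1 z.2.2.1 z.2.2.2.1 z.1

theorem contDiff_weight (i : ι) : ContDiff ℝ ∞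
    fun z : E × FlatParam ι E => z.2.1 i * cutoff E (z.1 - z.2.2.1 i) := by
  have h := cutoff_contDiff (E := E)
  have h1 : ContDiff ℝ ∞ fun z : E × FlatParam ι E => z.2.2.1 i := by fun_prop
  have h2 : ContDiff ℝ ∞ fun z : E × FlatParam ι E => z.2.1 i := by fun_prop
  exact h2.mul (h.comp (contDiff_fst.sub h1))

theorem contDiff_totalWeight : ContDiff ℝ ∞
    fun z : E × FlatParam ι E => totalWeight z.2.1 z.2.2.1 z.1 := by
  simp only [totalWeight, weightedSum]
  exact ContDiff.sum fun i _ => (contDiff_weight i).smul contDiff_const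

theorem contDiffAt_jointOperator {z : E × FlatParam ι E}
    (hz : totalWeight z.2.1 z.2.2.1 z.1 ≠ 0) : ContDiffAt ℝ ∞ jointOperator z := by
  have h : ContDiff ℝ ∞ fun z : E × FlatParam ι E =>
      weightedSum z.2.1 z.2.2.1 z.2.2.2.1 z.1 :=
    ContDiff.sum fun i _ => (contDiff_weight i).smul (by fun_prop)
  exact (contDiff_totalWeight.contDiffAt.inv hz).smul h.contDiffAt

theorem contDiffAt_normalError {z : E × FlatParam ι E}
    (hz : totalWeight z.2.1 z.2.2.1 z.1 ≠ 0)
    (hA : jointOperator z ∈ idempotentRetractionDomain (E →L[ℝ] E)) :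
    ContDiffAt ℝ ∞ normalError z := by
  have h : ContDiff ℝ ∞ fun z : E × FlatParam ι E =>
      weightedSum z.2.1 z.2.2.1 (fun i => z.2.2.2.1 i (z.1 - z.2.2.1 i)) z.1 := by
    refine ContDiff.sum fun i _ => (contDiff_weight i).smul ?_
    have h1 : ContDiff ℝ ∞ fun z : E × FlatParam ι E => z.2.2.1 i := by fun_prop
    have h2 : ContDiff ℝ ∞ fun z : E × FlatParam ι E => z.2.2.2.1 i := by fun_prop
    exact h2.clm_apply (contDiff_fst.sub h1)
  have h1 : ContDiffAt ℝ ∞ (fun z : E × FlatParam ι E =>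
      averageOffset z.2.1 z.2.2.1 z.2.2.2.1 z.1) z :=
    (contDiff_totalWeight.contDiffAt.inv hz).smul h.contDiffAt
  have h2 : ContDiffAt ℝ ∞ (fun z : E × FlatParam ι E =>
      idempotentRetraction (E →L[ℝ] E) (jointOperator z)) z :=
    (contDiffAt_idempotentRetraction hA).comp z (contDiffAt_jointOperator hz)
  have h3 : ContDiffAt ℝ ∞ (fun z : E × FlatParam ι E =>
      normalField z.2.1 z.2.2.1 z.2.2.2.1 z.1) z := h2.clm_apply h1
  have h4 : ContDiff ℝ ∞ fun z : E × FlatParam ι E => z.2.2.2.2 := by fun_prop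
  exact h4.contDiffAt.clm_apply (h3.sub contDiffAt_fst)

/-- The partial derivative of a smooth function is smooth. -/
theorem ContDiffAt.partial_fderiv {X W Y : Type*} [NormedAddCommGroup X] [NormedSpace ℝ X]
    [NormedAddCommGroup W] [NormedSpace ℝ W] [NormedAddCommGroup Y] [NormedSpace ℝ Y]
    {g : X × W → Y} {z : X × W} (hg : ContDiffAt ℝ ∞ g z) :
    ContDiffAt ℝ ∞ (fun z : X × W => fderiv ℝ (fun x => g (x, z.2)) z.1) z := by
  have h : ContDiff ℝ ∞ fun u : (X × W) × X => (u.2, u.1.2) := by fun_prop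
  refine ContDiffAt.fderiv (n := ∞) (f := fun (z : X × W) x => g (x, z.2)) (g := Prod.fst) ?_
    contDiffAt_fst (by simp)
  exact ContDiffAt.comp (x := (z, z.1)) (g := g) hg h.contDiffAt

/-- The first partial derivative of `normalError`. -/
def normalErrorDeriv (z : E × FlatParam ι E) : E →L[ℝ] E :=
  fderiv ℝ (fun x => normalError (x, z.2)) z.1

/-- The second partial derivative of `normalError`. -/
def normalErrorDeriv₂ (z : E × FlatParam ι E) : E →L[ℝ] E →L[ℝ] E :=
  fderiv ℝ (fun x => normalErrorDeriv (x, z.2)) z.1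

/-- The compact set of exactly flat parameters. -/
def flatParams (ι E : Type*) [Fintype ι] [NormedAddCommGroup E] [InnerProductSpace ℝ E]
    [FiniteDimensional ℝ E] : Set (E × FlatParam ι E) :=
  {z | ‖z.1‖ ≤ 1 ∧ (∀ i, z.2.1 i ∈ Icc (0 : ℝ) 1) ∧ (∀ i, ‖z.2.2.1 i‖ ≤ 10) ∧
    (∀ i, z.2.2.2.1 i = z.2.2.2.2) ∧ (∀ i, z.2.2.2.2 (z.2.2.1 i) = 0) ∧
    z.2.2.2.2 * z.2.2.2.2 = z.2.2.2.2 ∧ ‖z.2.2.2.2‖ ≤ 1 ∧ 1 ≤ totalWeight z.2.1 z.2.2.1 z.1}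

theorem isCompact_flatParams : IsCompact (flatParams ι E) := by
  have : ProperSpace (E →L[ℝ] E) := FiniteDimensional.proper_real _
  have : ProperSpace E := FiniteDimensional.proper_real _
  have hq : Continuous fun z : E × FlatParam ι E => z.2.2.2.2 := by fun_prop
  refine isCompact_of_isClosed_isBounded ?_ ?_
  · have hc : ∀ i, Continuous fun z : E × FlatParam ι E => z.2.1 i := fun i => by fun_prop
    have hy : ∀ i, Continuous fun z : E × FlatParam ι E => z.2.2.1 i := fun i => by fun_prop
    have hp : ∀ i, Continuous fun z : E × FlatParam ι E => z.2.2.2.1 i := fun i => by fun_prop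
    simp only [flatParams, Set.ofPred_and, Set.ofPred_forall]
    refine (isClosed_le continuous_fst.norm continuous_const).inter <|
      (isClosed_iInter fun i => isClosed_Icc.preimage (hc i)).inter <|
      (isClosed_iInter fun i => isClosed_le (hy i).norm continuous_const).inter <|
      (isClosed_iInter fun i => isClosed_eq (hp i) hq).inter <|
      (isClosed_iInter fun i => isClosed_eq (hq.clm_apply (hy i)) continuous_const).inter <|
      (isClosed_eq (hq.mul hq) hq).inter <|
      (isClosed_le hq.norm continuous_const).inter <|
      isClosed_le continuous_const contDiff_totalWeight.continuous
  · refine (isBounded_closedBall (x := (0 : E × FlatParam ι E)) (r := 10)).subset ?_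
    rintro ⟨x, c, y, p, q⟩ ⟨h1, h2, h3, h4, -, -, h7, -⟩
    simp only at h1 h2 h3 h4 h7
    rw [mem_closedBall_zero_iff]
    simp only [Prod.norm_def, sup_le_iff]
    refine ⟨by linarith, ?_, ?_, ?_, by linarith⟩
    · refine (pi_norm_le_iff_of_nonneg (by norm_num)).2 fun i => ?_
      rw [Real.norm_of_nonneg (h2 i).1]
      linarith [(h2 i).2]
    · exact (pi_norm_le_iff_of_nonneg (by norm_num)).2 h3
    · refine (pi_norm_le_iff_of_nonneg (by norm_num)).2 fun i => ?_
      rw [h4]; linarith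

/-- Positivity of the total weight is open in `x`, and wherever it holds flat data reproduce `q`
exactly. Having this on a neighbourhood, not just at the point, is what makes the derivatives vanish
too. -/
theorem eventually_normalError_eq_zero {z : E × FlatParam ι E} (hz : z ∈ flatParams ι E) :
    ∀ᶠ x in 𝓝 z.1, normalError (x, z.2) = 0 := by
  obtain ⟨-, -, -, h4, h5, h6, -, h8⟩ := hz
  have hc : Continuous fun x : E => totalWeight z.2.1 z.2.2.1 x :=
    contDiff_totalWeight.continuous.comp (by fun_prop : Continuous fun x : E => (x, z.2))
  filter_upwards [hc.continuousAt.eventually (lt_mem_nhds (lt_of_lt_of_le one_pos h8))]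
    with x hx
  simp only [normalError, normalField_eq_of_flat h4 h5 h6 hx.ne', map_sub]
  rw [sub_eq_zero]
  exact congrArg (fun f : E →L[ℝ] E => f x) h6

/-- Near exactly flat parameters, `normalField` is `C²`-close to the reference projection. -/
theorem eventually_near_flat {σ : ℝ} (hσ : 0 < σ) {z : E × FlatParam ι E}
    (hz : z ∈ flatParams ι E) :
    ∀ᶠ z in 𝓝 z, ContDiffAt ℝ ∞ normalError z ∧ ‖normalError z‖ < σ ∧
      ‖normalErrorDeriv z‖ < σ ∧ ‖normalErrorDeriv₂ z‖ < σ ∧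
      jointOperator z ∈ idempotentRetractionDomain (E →L[ℝ] E) ∧
      ‖idempotentRetraction (E →L[ℝ] E) (jointOperator z) - z.2.2.2.2‖ < 1 / 2 := by
  have hz0 := eventually_normalError_eq_zero hz
  obtain ⟨-, -, -, h4, -, h6, -, h8⟩ := hz
  have hpos : 0 < totalWeight z.2.1 z.2.2.1 z.1 := by linarith
  have hjoint : jointOperator z = z.2.2.2.2 := averageOperator_eq_of_flat h4 hpos.ne'
  have hdom : jointOperator z ∈ idempotentRetractionDomain (E →L[ℝ] E) := by
    rw [hjoint]; exact mem_idempotentRetractionDomain h6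
  have hsm := contDiffAt_normalError hpos.ne' hdom
  -- The partial derivatives in `x` are smooth jointly in point and parameters, so their smallness
  -- persists when the parameters move.
  have hsm1 : ContDiffAt ℝ ∞ (normalErrorDeriv (ι := ι) (E := E)) z := hsm.partial_fderiv
  have hsm2 : ContDiffAt ℝ ∞ (normalErrorDeriv₂ (ι := ι) (E := E)) z := hsm1.partial_fderiv
  have e0 : normalError z = 0 := hz0.self_of_nhds
  have ev1 : ∀ᶠ x in 𝓝 z.1, normalErrorDeriv (x, z.2) = 0 := by
    filter_upwards [hz0.eventually_nhds] with x hx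
    have : (fun x => normalError (x, z.2)) =ᶠ[𝓝 x] fun _ => 0 := hx
    simp [normalErrorDeriv, this.fderiv_eq]
  have e1 : normalErrorDeriv z = 0 := ev1.self_of_nhds
  have e2 : normalErrorDeriv₂ z = 0 := by
    have : (fun x => normalErrorDeriv (x, z.2)) =ᶠ[𝓝 z.1] fun _ => 0 := ev1
    simp [normalErrorDeriv₂, this.fderiv_eq]
  have hjc : ContinuousAt (jointOperator (ι := ι) (E := E)) z :=
    (contDiffAt_jointOperator hpos.ne').continuousAt
  have evdom : ∀ᶠ z in 𝓝 z, jointOperator z ∈ idempotentRetractionDomain (E →L[ℝ] E) :=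
    hjc.eventually (isOpen_idempotentRetractionDomain.mem_nhds hdom)
  have evpos : ∀ᶠ z : E × FlatParam ι E in 𝓝 z, 0 < totalWeight z.2.1 z.2.2.1 z.1 :=
    contDiff_totalWeight.continuous.continuousAt.eventually (lt_mem_nhds hpos)
  have hq : Continuous fun z : E × FlatParam ι E => z.2.2.2.2 := by fun_prop
  have hdc : ContinuousAt (fun z : E × FlatParam ι E =>
      ‖idempotentRetraction (E →L[ℝ] E) (jointOperator z) - z.2.2.2.2‖) z :=
    (((contDiffAt_idempotentRetraction hdom).continuousAt.comp hjc).sub hq.continuousAt).norm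
  have hn2 : ContinuousAt (fun z : E × FlatParam ι E => ‖normalErrorDeriv₂ z‖) z :=
    (continuous_norm (E := E →L[ℝ] E →L[ℝ] E)).continuousAt.comp hsm2.continuousAt
  filter_upwards [evdom, evpos,
    hsm.continuousAt.norm.eventually_lt (continuousAt_const (y := σ)) (by simpa [e0] using hσ),
    hsm1.continuousAt.norm.eventually_lt (continuousAt_const (y := σ)) (by simpa [e1] using hσ),
    hn2.eventually_lt (continuousAt_const (y := σ))
      (by rw [e2]; exact (norm_zero (E := E →L[ℝ] E →L[ℝ] E)).trans_lt hσ),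
    hdc.eventually_lt (continuousAt_const (y := (1 / 2 : ℝ)))
      (by simp [hjoint, idempotentRetraction_of_idempotent h6])]
    with u h1 h2 h3 h4 h5 h6
  exact ⟨contDiffAt_normalError h2.ne' h1, h3, h4, h5, h1, h6⟩

/-- For almost flat data, `normalField` is `C²`-close to the reference projection on the unit
ball, and it vanishes as soon as its reference component does. -/
theorem exists_almost_flat (ι E : Type*) [Fintype ι] [NormedAddCommGroup E]
    [InnerProductSpace ℝ E] [FiniteDimensional ℝ E] {σ : ℝ} (hσ : 0 < σ) :
    ∃ η : ℝ, 0 < η ∧ η ≤ 1 ∧ ∀ (c : ι → ℝ) (y : ι → E) (p : ι → E →L[ℝ] E) (q : E →L[ℝ] E),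
      (∀ i, c i ∈ Icc (0 : ℝ) 1) → (∀ i, ‖y i‖ ≤ 9) → (∀ i, ‖p i - q‖ ≤ η) →
      (∀ i, ‖q (y i)‖ ≤ η) → q * q = q → ‖q‖ ≤ 1 → (∃ i, c i = 1 ∧ ‖y i‖ ≤ 1) →
      ContDiffOn ℝ ∞ (fun x => q (normalField c y p x - x)) (ball 0 1) ∧
      ∀ x ∈ ball (0 : E) 1, ‖q (normalField c y p x - x)‖ ≤ σ ∧
        ‖fderiv ℝ (fun x => q (normalField c y p x - x)) x‖ ≤ σ ∧
        ‖fderiv ℝ (fderiv ℝ fun x => q (normalField c y p x - x)) x‖ ≤ σ ∧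
        (q (normalField c y p x) = 0 → normalField c y p x = 0) := by
  let P : E × FlatParam ι E → Prop := fun z => ContDiffAt ℝ ∞ normalError z ∧
      ‖normalError z‖ < σ ∧ ‖normalErrorDeriv z‖ < σ ∧ ‖normalErrorDeriv₂ z‖ < σ ∧
      jointOperator z ∈ idempotentRetractionDomain (E →L[ℝ] E) ∧
      ‖idempotentRetraction (E →L[ℝ] E) (jointOperator z) - z.2.2.2.2‖ < 1 / 2
  have hK : flatParams ι E ⊆ interior {z | P z} := fun z hz =>
    mem_interior_iff_mem_nhds.2 (eventually_near_flat hσ hz)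
  obtain ⟨d, hd, hsub⟩ :=
    isCompact_flatParams.exists_thickening_subset_open isOpen_interior hK
  refine ⟨min 1 (d / 2), by positivity, min_le_left _ _, ?_⟩
  intro c y p q hc hy hp hqy hqq hq1 ⟨i₀, hi₀, hyi₀⟩
  have hη1 : min 1 (d / 2) ≤ 1 := min_le_left _ _
  have hηd : min 1 (d / 2) < d := lt_of_le_of_lt (min_le_right _ _) (by linarith)
  have hqq' : ∀ v, q (q v) = q v := fun v => congrArg (fun f : E →L[ℝ] E => f v) hqq
  have hP : ∀ x ∈ ball (0 : E) 1, P (x, c, y, p, q) := by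
    intro x hx
    rw [mem_ball_zero_iff] at hx
    -- The comparison point of the compact set: base points are moved into the kernel of `q` and all
    -- operators replaced by `q`. Each change is at most `η ≤ 1`, hence the radius `10` in
    -- `flatParams` against `9` here, and some cutoff still equals `1`, its argument having norm at
    -- most `3`.
    have hmem : ((x, c, (fun i => y i - q (y i)), (fun _ => q), q) : E × FlatParam ι E) ∈
        flatParams ι E := by
      refine ⟨hx.le, hc, fun i => ?_, fun i => rfl, fun i => ?_, hqq, hq1, ?_⟩
      · have := norm_sub_le (y i) (q (y i))
        linarith [hy i, hqy i]
      · simp [hqq']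
      · have h1 : c i₀ * cutoff E (x - (y i₀ - q (y i₀))) = 1 := by
          rw [hi₀, one_mul]
          refine cutoff_eq_one ?_
          have a1 := norm_sub_le x (y i₀ - q (y i₀))
          have a2 := norm_sub_le (y i₀) (q (y i₀))
          linarith [hqy i₀]
        simp only [totalWeight, weightedSum, smul_eq_mul, mul_one]
        rw [← h1]
        exact Finset.single_le_sum
          (f := fun i => c i * cutoff E (x - (y i - q (y i))))
          (fun i _ => mul_nonneg (hc i).1 (cutoff E).nonneg) (Finset.mem_univ i₀)
    have := hsub (Metric.mem_thickening_iff.2 ⟨_, hmem, ?_⟩ : ((x, c, y, p, q) :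
      E × FlatParam ι E) ∈ thickening d (flatParams ι E))
    · exact (interior_subset this : (x, c, y, p, q) ∈ {z | P z})
    · simp only [Prod.dist_eq, dist_self]
      refine lt_of_le_of_lt ?_ hηd
      have hη0 : 0 ≤ min 1 (d / 2) := by positivity
      refine max_le hη0 (max_le hη0 (max_le ?_ (max_le ?_ hη0)))
      · refine (dist_pi_le_iff hη0).2 fun i => ?_
        simpa [dist_eq_norm] using hqy i
      · refine (dist_pi_le_iff hη0).2 fun i => ?_
        simpa [dist_eq_norm] using hp i
  refine ⟨fun x hx => ?_, fun x hx => ?_⟩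
  · have h1 := (hP x hx).1
    have h2 : ContDiff ℝ ∞ fun x : E => ((x, c, y, p, q) : E × FlatParam ι E) := by fun_prop
    exact (ContDiffAt.comp (g := normalError) x h1 h2.contDiffAt).contDiffWithinAt
  · obtain ⟨-, h2, h3, h4, h5, h6⟩ := hP x hx
    refine ⟨h2.le, h3.le, h4.le, fun h => ?_⟩
    set v := normalField c y p x with hv
    set T := idempotentRetraction (E →L[ℝ] E) (averageOperator c y p x) with hT
    have hTT : T * T = T := idempotentRetraction_mul_self h5
    have hTv : T v = v := congrArg (fun f : E →L[ℝ] E => f (averageOffset c y p x)) hTT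
    -- The field lies in the range of the idempotent `T`, and `T` is within `1 / 2` of `q`, so `q`
    -- is injective on that range.
    have h7 : ‖v‖ ≤ ‖T - q‖ * ‖v‖ := by
      calc ‖v‖ = ‖(T - q) v‖ := by simp [hTv, h]
        _ ≤ _ := (T - q).le_opNorm v
    have h8 : ‖T - q‖ < 1 / 2 := h6
    exact norm_le_zero_iff.1 (by nlinarith [norm_nonneg v])

end NormalField

/-! ### Geometry of almost flat charts -/

section Charts

variable {E : Type*} [NormedAddCommGroup E] [InnerProductSpace ℝ E]

/-- On the ball `B(x₀, ρ)` the set `M` is the preimage of the subspace `V` under a smooth map `H`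
which is `C²`-close to the translation `z ↦ z - x₀`, with scale-invariant bounds. -/
structure IsAlmostFlatChart (σ ρ : ℝ) (x₀ : E) (V : Submodule ℝ E) (H : E → E) (M : Set E) :
    Prop where
  contDiffOn : ContDiffOn ℝ ∞ H (ball x₀ ρ)
  norm_sub_le : ∀ z ∈ ball x₀ ρ, ‖H z - (z - x₀)‖ ≤ σ * ρ
  norm_fderiv_le : ∀ z ∈ ball x₀ ρ, ‖fderiv ℝ H z - ContinuousLinearMap.id ℝ E‖ ≤ σ
  norm_fderiv₂_le : ∀ z ∈ ball x₀ ρ, ∀ v w, ‖fderiv ℝ (fderiv ℝ H) z v w‖ ≤ σ / ρ * ‖v‖ * ‖w‖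
  mem_iff : ∀ z ∈ ball x₀ ρ, (z ∈ M ↔ H z ∈ V)

namespace IsAlmostFlatChart

variable {σ ρ : ℝ} {x₀ : E} {V : Submodule ℝ E} {H : E → E} {M : Set E}

theorem contDiffAt (h : IsAlmostFlatChart σ ρ x₀ V H M) {z : E} (hz : z ∈ ball x₀ ρ) :
    ContDiffAt ℝ ∞ H z :=
  h.contDiffOn.contDiffAt (isOpen_ball.mem_nhds hz)

theorem differentiableAt (h : IsAlmostFlatChart σ ρ x₀ V H M) {z : E} (hz : z ∈ ball x₀ ρ) :
    DifferentiableAt ℝ H z :=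
  (h.contDiffAt hz).differentiableAt (by simp)

theorem approximatesLinearOn (h : IsAlmostFlatChart σ ρ x₀ V H M) (hσ : 0 ≤ σ) :
    ApproximatesLinearOn H (ContinuousLinearMap.id ℝ E) (ball x₀ ρ) ⟨σ, hσ⟩ := fun _ hx _ hy =>
  Convex.norm_image_sub_le_of_norm_fderiv_le' (fun _ hz => h.differentiableAt hz)
    h.norm_fderiv_le (convex_ball x₀ ρ) hy hx

theorem norm_sub_le_two_mul (h : IsAlmostFlatChart σ ρ x₀ V H M) (hσ : 0 ≤ σ) (hσ' : σ ≤ 1 / 8)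
    {x y : E} (hx : x ∈ ball x₀ ρ) (hy : y ∈ ball x₀ ρ) : ‖x - y‖ ≤ 2 * ‖H x - H y‖ := by
  have h1 : ‖H x - H y - (x - y)‖ ≤ σ * ‖x - y‖ := h.approximatesLinearOn hσ x hx y hy
  have h2 := norm_sub_norm_le (x - y) (H x - H y)
  rw [norm_sub_rev (x - y)] at h2
  nlinarith [norm_nonneg (x - y)]

/-- A perturbation of the identity with Lipschitz constant `σ` covers a ball of radius `(1 - σ)`
times the original. With original radius `3ρ/4` this is at least `ρ/2 + ρ/8`, which absorbs the
displacement of `H x₀` from `0`. -/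
theorem exists_preimage [CompleteSpace E] (h : IsAlmostFlatChart σ ρ x₀ V H M) (hσ : 0 ≤ σ)
    (hσ' : σ ≤ 1 / 8) (hρ : 0 < ρ) {v : E} (hv : ‖v‖ ≤ ρ / 2) :
    ∃ z ∈ ball x₀ ρ, H z = v ∧ ‖z - x₀‖ ≤ ‖v‖ + σ * ρ := by
  let r : (ContinuousLinearMap.id ℝ E).NonlinearRightInverse :=
    ⟨id, 1, fun y => by simp, fun y => rfl⟩
  have h0 := h.norm_sub_le x₀ (mem_ball_self hρ)
  rw [sub_self, sub_zero] at h0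
  have hs := (h.approximatesLinearOn hσ).surjOn_closedBall_of_nonlinearRightInverse r
    (ε := 3 / 4 * ρ) (b := x₀) (by positivity) (closedBall_subset_ball (by linarith))
  have hmem : v ∈ closedBall (H x₀) (((r.nnnorm : ℝ)⁻¹ - ((⟨σ, hσ⟩ : NNReal) : ℝ)) *
      (3 / 4 * ρ)) := by
    rw [mem_closedBall, dist_eq_norm]
    have h2 := _root_.norm_sub_le v (H x₀)
    have h3 : (((r.nnnorm : ℝ)⁻¹ - ((⟨σ, hσ⟩ : NNReal) : ℝ)) * (3 / 4 * ρ)) =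
        (1 - σ) * (3 / 4 * ρ) := by simp [r]
    rw [h3]
    nlinarith
  obtain ⟨z, hz, rfl⟩ := hs hmem
  have hz' : z ∈ ball x₀ ρ := closedBall_subset_ball (by linarith) hz
  refine ⟨z, hz', rfl, ?_⟩
  have h2 := h.norm_sub_le z hz'
  have h3 := norm_sub_norm_le (z - x₀) (H z)
  rw [norm_sub_rev (z - x₀) (H z)] at h3
  linarith

theorem exists_mem_dist_le [CompleteSpace E] (h : IsAlmostFlatChart σ ρ x₀ V H M) (hσ : 0 ≤ σ)
    (hσ' : σ ≤ 1 / 8) (hρ : 0 < ρ) : ∃ z ∈ M, dist z x₀ ≤ σ * ρ := by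
  obtain ⟨z, hz, hz0, hd⟩ := h.exists_preimage hσ hσ' hρ (v := 0) (by simp; positivity)
  refine ⟨z, (h.mem_iff z hz).2 (by simp [hz0]), ?_⟩
  simpa [dist_eq_norm] using hd

/-- The connected piece is the image of the convex set `V ∩ B(0, ρ/2)` under the inverse of `H`,
which is `2`-Lipschitz. -/
theorem exists_isConnected [CompleteSpace E] (h : IsAlmostFlatChart σ ρ x₀ V H M) (hσ : 0 ≤ σ)
    (hσ' : σ ≤ 1 / 8) (hρ : 0 < ρ) :
    ∃ C, IsConnected C ∧ C ⊆ M ∩ ball x₀ ρ ∧ M ∩ ball x₀ (ρ / 4) ⊆ C := by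
  choose! g hg using fun (v : E) (hv : ‖v‖ ≤ ρ / 2) => h.exists_preimage hσ hσ' hρ hv
  have hball : ∀ v ∈ (V : Set E) ∩ ball 0 (ρ / 2), ‖v‖ ≤ ρ / 2 := fun v hv =>
    (mem_ball_zero_iff.1 hv.2).le
  refine ⟨g '' ((V : Set E) ∩ ball 0 (ρ / 2)), ?_, ?_, ?_⟩
  · have hconv : Convex ℝ ((V : Set E) ∩ ball 0 (ρ / 2)) :=
      V.convex.inter (convex_ball _ _)
    refine ⟨⟨g 0, mem_image_of_mem g ⟨V.zero_mem, mem_ball_self (by positivity)⟩⟩,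
      hconv.isPreconnected.image g ?_⟩
    have : LipschitzOnWith 2 g ((V : Set E) ∩ ball 0 (ρ / 2)) := by
      refine LipschitzOnWith.of_dist_le_mul fun v hv w hw => ?_
      obtain ⟨a1, a2, -⟩ := hg v (hball v hv)
      obtain ⟨b1, b2, -⟩ := hg w (hball w hw)
      have := h.norm_sub_le_two_mul hσ hσ' a1 b1
      rw [a2, b2] at this
      simpa [dist_eq_norm] using this
    exact this.continuousOn
  · rintro _ ⟨v, hv, rfl⟩
    obtain ⟨a1, a2, -⟩ := hg v (hball v hv)
    exact ⟨(h.mem_iff _ a1).2 (by rw [a2]; exact hv.1), a1⟩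
  · rintro z ⟨hzM, hz⟩
    have hz' : z ∈ ball x₀ ρ := ball_subset_ball (by linarith) hz
    rw [mem_ball, dist_eq_norm] at hz
    have h1 := h.norm_sub_le z hz'
    have h2 := norm_sub_norm_le (H z) (z - x₀)
    have hv : H z ∈ (V : Set E) ∩ ball 0 (ρ / 2) := by
      refine ⟨(h.mem_iff z hz').1 hzM, mem_ball_zero_iff.2 ?_⟩
      nlinarith
    refine ⟨H z, hv, ?_⟩
    obtain ⟨a1, a2, -⟩ := hg _ (hball _ hv)
    have := h.norm_sub_le_two_mul hσ hσ' a1 hz'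
    rw [a2, sub_self, norm_zero, mul_zero] at this
    exact sub_eq_zero.1 (norm_le_zero_iff.1 this)

theorem exists_hasFDerivAt_equiv [FiniteDimensional ℝ E] (h : IsAlmostFlatChart σ ρ x₀ V H M)
    (hσ' : σ ≤ 1 / 8) {z : E} (hz : z ∈ ball x₀ ρ) :
    ∃ f' : E ≃L[ℝ] E, HasFDerivAt H (f' : E →L[ℝ] E) z := by
  have hinj : Function.Injective (fderiv ℝ H z) := by
    refine (injective_iff_map_eq_zero _).2 fun v hv => ?_
    have h1 := (fderiv ℝ H z - ContinuousLinearMap.id ℝ E).le_of_opNorm_le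
      (h.norm_fderiv_le z hz) v
    simp only [sub_apply, hv, ContinuousLinearMap.id_apply, zero_sub,
      norm_neg] at h1
    exact norm_le_zero_iff.1 (by nlinarith [norm_nonneg v])
  refine ⟨(LinearEquiv.ofInjectiveEndo (fderiv ℝ H z : E →ₗ[ℝ] E)
    hinj).toContinuousLinearEquiv, ?_⟩
  refine (h.differentiableAt hz).hasFDerivAt.congr_fderiv ?_
  ext v
  rfl

end IsAlmostFlatChart

/-- A set with almost flat charts around each of its points is a smooth submanifold. -/
theorem IsAlmostFlatChart.exists_isLocalParametrization {n k : ℕ} {σ ρ : ℝ}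
    {x₀ : EuclideanSpace ℝ (Fin n)} {V : Submodule ℝ (EuclideanSpace ℝ (Fin n))}
    {H : EuclideanSpace ℝ (Fin n) → EuclideanSpace ℝ (Fin n)}
    {M : Set (EuclideanSpace ℝ (Fin n))} (h : IsAlmostFlatChart σ ρ x₀ V H M) (hσ : 0 ≤ σ)
    (hσ' : σ ≤ 1 / 8) (hV : Module.finrank ℝ V = k) {z : EuclideanSpace ℝ (Fin n)}
    (hz : z ∈ M) (hzb : z ∈ ball x₀ ρ) :
    ∃ (U : Set (EuclideanSpace ℝ (Fin k)))
      (φ : EuclideanSpace ℝ (Fin k) → EuclideanSpace ℝ (Fin n)),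
      IsLocalParametrization M U φ ∧ z ∈ φ '' U := by
  let e : OpenPartialHomeomorph (EuclideanSpace ℝ (Fin n)) (EuclideanSpace ℝ (Fin n)) :=
    ApproximatesLinearOn.toOpenPartialHomeomorph H (ball x₀ ρ)
      (f' := ContinuousLinearEquiv.refl ℝ _) (h.approximatesLinearOn hσ) (by
        -- The identity has norm `1` only on a nontrivial space, so dimension `0` is treated apart.
        rcases subsingleton_or_nontrivial (EuclideanSpace ℝ (Fin n)) with h1 | h1
        · exact Or.inl h1
        · right
          have : ‖((ContinuousLinearEquiv.refl ℝ (EuclideanSpace ℝ (Fin n))).symm :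
            EuclideanSpace ℝ (Fin n) →L[ℝ] EuclideanSpace ℝ (Fin n))‖₊ = 1 := by
            ext; exact ContinuousLinearMap.norm_id
          rw [this, inv_one]
          exact_mod_cast (by linarith : σ < 1)) isOpen_ball
  have he : ∀ x, e x = H x := fun x => rfl
  have hes : e.source = ball x₀ ρ := rfl
  have b : OrthonormalBasis (Fin k) ℝ V := (stdOrthonormalBasis ℝ V).reindex (finCongr hV)
  let ι : EuclideanSpace ℝ (Fin k) →ₗᵢ[ℝ] EuclideanSpace ℝ (Fin n) :=
    V.subtypeₗᵢ.comp b.repr.symm.toLinearIsometry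
  have hιV : ∀ u, ι u ∈ V := fun u => (b.repr.symm u).2
  have hιs : ∀ v ∈ V, ∃ u, ι u = v := fun v hv => ⟨b.repr ⟨v, hv⟩, by simp [ι]⟩
  let U : Set (EuclideanSpace ℝ (Fin k)) := ι ⁻¹' e.target
  -- The parametrization is the inverse of `H` restricted to `V`, with `V` identified isometrically
  -- with `ℝᵏ`. Since `H ∘ φ = ι`, it inherits injectivity of the derivative and the embedding
  -- property from `ι`.
  let φ : EuclideanSpace ℝ (Fin k) → EuclideanSpace ℝ (Fin n) := fun u => e.symm (ι u)
  have hsm : ∀ y ∈ e.target, ContDiffAt ℝ ∞ e.symm y := by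
    intro y hy
    have hyb : e.symm y ∈ ball x₀ ρ := e.map_target hy
    obtain ⟨f', hf'⟩ := h.exists_hasFDerivAt_equiv hσ' hyb
    exact e.contDiffAt_symm hy hf' (h.contDiffAt hyb)
  have hφs : ∀ u ∈ U, ContDiffAt ℝ ∞ φ u := fun u hu =>
    (hsm _ hu).comp u ι.contDiff.contDiffAt
  have hHφ : ∀ u ∈ U, H (φ u) = ι u := fun u hu => e.right_inv hu
  have hUo : IsOpen U := e.open_target.preimage ι.continuous
  have hφb : ∀ u ∈ U, φ u ∈ ball x₀ ρ := fun u hu => e.map_target hu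
  refine ⟨U, φ, ⟨hUo, fun u hu => (hφs u hu).contDiffWithinAt, ?_, ?_, ?_⟩, ?_⟩
  · intro u hu
    have h1 : HasFDerivAt (fun u => H (φ u)) ((fderiv ℝ H (φ u)).comp (fderiv ℝ φ u)) u :=
      (h.differentiableAt (hφb u hu)).hasFDerivAt.comp u
        ((hφs u hu).differentiableAt (by simp)).hasFDerivAt
    have h2 : HasFDerivAt (fun u => H (φ u)) ι.toContinuousLinearMap u :=
      ι.toContinuousLinearMap.hasFDerivAt.congr_of_eventuallyEq (by
        filter_upwards [hUo.mem_nhds hu] with w hw using hHφ w hw)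
    have h3 := h1.unique h2
    refine Function.Injective.of_comp (f := fderiv ℝ H (φ u)) ?_
    have h4 : (fderiv ℝ H (φ u)) ∘ (fderiv ℝ φ u) = ι := by
      rw [← ContinuousLinearMap.coe_comp, h3]; rfl
    rw [h4]
    exact ι.injective
  · have hc : Continuous fun u : U => (⟨φ u, hφb u u.2⟩ : ball x₀ ρ) := by
      refine Continuous.subtype_mk ?_ _
      exact continuousOn_iff_continuous_domRestrict.1
        fun u hu => (hφs u hu).continuousAt.continuousWithinAt
    have hc2 : Continuous fun z : ball x₀ ρ => H z :=
      continuousOn_iff_continuous_domRestrict.1 h.contDiffOn.continuousOn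
    have h1 : IsEmbedding ((fun z : ball x₀ ρ => H z) ∘
        fun u : U => (⟨φ u, hφb u u.2⟩ : ball x₀ ρ)) := by
      have : ((fun z : ball x₀ ρ => H z) ∘ fun u : U => (⟨φ u, hφb u u.2⟩ : ball x₀ ρ)) =
          ι ∘ Subtype.val := by
        ext1 u
        exact hHφ u u.2
      rw [this]
      exact ι.isometry.isEmbedding.comp IsEmbedding.subtypeVal
    exact IsEmbedding.subtypeVal.comp (IsEmbedding.of_comp hc hc2 h1)
  · refine ⟨ball x₀ ρ, isOpen_ball, Subset.antisymm ?_ ?_⟩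
    · rintro _ ⟨u, hu, rfl⟩
      refine ⟨(h.mem_iff _ (hφb u hu)).2 ?_, hφb u hu⟩
      rw [hHφ u hu]
      exact hιV u
    · rintro y ⟨hyM, hyb⟩
      obtain ⟨u, hu⟩ := hιs _ ((h.mem_iff y hyb).1 hyM)
      have hyt : H y ∈ e.target := e.map_source hyb
      refine ⟨u, by simpa [U, hu] using hyt, ?_⟩
      simp only [φ, hu]
      exact e.left_inv hyb
  · obtain ⟨u, hu⟩ := hιs _ ((h.mem_iff z hzb).1 hz)
    have hyt : H z ∈ e.target := e.map_source hzb
    refine ⟨u, by simpa [U, hu] using hyt, ?_⟩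
    simp only [φ, hu]
    exact e.left_inv hzb

end Charts

/-! ### Bound on the second fundamental form -/

section Curvature

open scoped MatrixOrder ComplexOrder Matrix.Norms.L2Operator in
/-- The inverse of a positive definite matrix `g` is `Cᵀ C`, where `C g Cᵀ = 1`. -/
theorem Matrix.PosDef.exists_inv_eq_transpose_mul_self {k : ℕ} {g : Matrix (Fin k) (Fin k) ℝ}
    (hg : g.PosDef) : ∃ C : Matrix (Fin k) (Fin k) ℝ, g⁻¹ = C.transpose * C ∧
      C * g * C.transpose = 1 := by
  obtain ⟨C, hC⟩ := CStarAlgebra.nonneg_iff_eq_star_mul_self.mp hg.inv.posSemidef.nonneg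
  rw [Matrix.star_eq_conjTranspose, Matrix.conjTranspose_eq_transpose_of_trivial] at hC
  refine ⟨C, hC, ?_⟩
  have h1 : g⁻¹ * g = 1 := Matrix.nonsing_inv_mul g ((Matrix.isUnit_iff_isUnit_det g).1 hg.isUnit)
  rw [hC, Matrix.mul_assoc] at h1
  exact mul_eq_one_comm.1 h1

/-- A bound for a bilinear form of the type of the second fundamental form gives a bound for its
norm with respect to the metric `g`. -/
theorem sum_inv_gram_le {F : Type*} [NormedAddCommGroup F] [InnerProductSpace ℝ F] {k : ℕ}
    {t : Fin k → F} (ht : LinearIndependent ℝ t) (A : Fin k → Fin k → F) {c : ℝ} (hc : 0 ≤ c)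
    (hA : ∀ a b : Fin k → ℝ, ‖∑ i, ∑ j, (a i * b j) • A i j‖ ≤
      c * ‖∑ i, a i • t i‖ * ‖∑ j, b j • t j‖) :
    √(∑ i, ∑ j, ∑ p, ∑ q, (Matrix.gram ℝ t)⁻¹ i p * (Matrix.gram ℝ t)⁻¹ j q *
      ⟪A i j, A p q⟫_ℝ) ≤ k * c := by
  obtain ⟨C, hC, hC1⟩ :=
    (Matrix.posDef_gram_of_linearIndependent ht).exists_inv_eq_transpose_mul_self
  -- The rows of `C` are the coordinates of an orthonormal basis of the span of `t`. In that basis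
  -- the squared norm is a sum of `k²` terms, each at most `c²`, hence the factor `k`.
  have hnorm : ∀ m, ‖∑ i, C m i • t i‖ = 1 := by
    intro m
    have h1 : ‖∑ i, C m i • t i‖ ^ 2 = (C * Matrix.gram ℝ t * C.transpose) m m := by
      rw [← real_inner_self_eq_norm_sq]
      simp only [sum_inner, inner_sum, real_inner_smul_left, real_inner_smul_right,
        Matrix.mul_apply, Matrix.transpose_apply, Matrix.gram, Matrix.of_apply, Finset.sum_mul]
      rw [Finset.sum_comm]
      refine Finset.sum_congr rfl fun j _ => Finset.sum_congr rfl fun i _ => ?_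
      rw [real_inner_comm]
      ring
    rw [hC1, Matrix.one_apply_eq] at h1
    exact (pow_eq_one_iff_of_nonneg (norm_nonneg _) two_ne_zero).1 h1
  have hsum : (∑ i, ∑ j, ∑ p, ∑ q, (Matrix.gram ℝ t)⁻¹ i p * (Matrix.gram ℝ t)⁻¹ j q *
      ⟪A i j, A p q⟫_ℝ) = ∑ m, ∑ l, ‖∑ i, ∑ j, (C m i * C l j) • A i j‖ ^ 2 := by
    have h1 : ∀ m l, ‖∑ i, ∑ j, (C m i * C l j) • A i j‖ ^ 2 =
        ∑ i, ∑ j, ∑ p, ∑ q, (C m i * C m p) * (C l j * C l q) * ⟪A i j, A p q⟫_ℝ := by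
      intro m l
      rw [← real_inner_self_eq_norm_sq]
      simp only [sum_inner, inner_sum, real_inner_smul_left, real_inner_smul_right]
      refine Finset.sum_congr rfl fun i _ => Finset.sum_congr rfl fun j _ =>
        Finset.sum_congr rfl fun p _ => Finset.sum_congr rfl fun q _ => ?_
      rw [real_inner_comm]
      ring
    have hcomm : ∀ f : Fin k → Fin k → Fin k → ℝ,
        ∑ m, ∑ l, ∑ i, f m l i = ∑ i, ∑ m, ∑ l, f m l i := by
      intro f
      rw [Finset.sum_congr rfl fun m _ => Finset.sum_comm]
      exact Finset.sum_comm
    simp only [h1, hC, Matrix.mul_apply, Matrix.transpose_apply]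
    refine Eq.symm <| (hcomm _).trans <| Finset.sum_congr rfl fun i _ => (hcomm _).trans <|
      Finset.sum_congr rfl fun j _ => (hcomm _).trans <| Finset.sum_congr rfl fun p _ =>
      (hcomm _).trans <| Finset.sum_congr rfl fun q _ => ?_
    rw [Finset.sum_mul_sum, Finset.sum_mul]
    exact Finset.sum_congr rfl fun m _ => (Finset.sum_mul _ _ _).symm
  rw [hsum]
  refine Real.sqrt_le_iff.2 ⟨by positivity, ?_⟩
  have hle : ∀ m l, ‖∑ i, ∑ j, (C m i * C l j) • A i j‖ ^ 2 ≤ c ^ 2 := by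
    intro m l
    have := hA (C m) (C l)
    rw [hnorm, hnorm, mul_one, mul_one] at this
    exact pow_le_pow_left₀ (norm_nonneg _) this 2
  calc _ ≤ ∑ m : Fin k, ∑ l : Fin k, c ^ 2 :=
        Finset.sum_le_sum fun m _ => Finset.sum_le_sum fun l _ => hle m l
    _ = (k * c) ^ 2 := by simp; ring

variable {E : Type*} [NormedAddCommGroup E] [InnerProductSpace ℝ E]

/-- If `L` is close to the identity and maps a subspace `S` onto `V`, then the normal component of
`L ν` controls every vector `ν` normal to `S`. -/
theorem norm_le_two_mul_norm_starProjection [FiniteDimensional ℝ E] {S V : Submodule ℝ E}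
    {L : E →L[ℝ] E} {σ : ℝ} (hσ : 0 ≤ σ) (hσ' : σ ≤ 1 / 8)
    (hL : ‖L - ContinuousLinearMap.id ℝ E‖ ≤ σ) (hSV : ∀ s ∈ S, L s ∈ V)
    (hfin : Module.finrank ℝ S = Module.finrank ℝ V) {ν : E} (hν : ν ∈ Sᗮ) :
    ‖ν‖ ≤ 2 * ‖Vᗮ.starProjection (L ν)‖ := by
  have hL' : ∀ v, ‖L v - v‖ ≤ σ * ‖v‖ := fun v => by
    simpa using (L - ContinuousLinearMap.id ℝ E).le_of_opNorm_le hL v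
  have hLinj : Function.Injective L := by
    refine (injective_iff_map_eq_zero _).2 fun v hv => ?_
    have h1 := hL' v
    rw [hv, zero_sub, norm_neg] at h1
    exact norm_le_zero_iff.1 (by nlinarith [norm_nonneg v])
  have hmap : S.map (L : E →ₗ[ℝ] E) = V := by
    refine Submodule.eq_of_le_of_finrank_eq ?_ ?_
    · rintro _ ⟨s, hs, rfl⟩
      exact hSV s hs
    · rw [← hfin]
      exact (Submodule.equivMapOfInjective (L : E →ₗ[ℝ] E) hLinj S).finrank_eq.symm
  set p := V.starProjection ν with hp
  obtain ⟨t, htS, ht⟩ : ∃ t ∈ S, L t = p := by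
    have : p ∈ S.map (L : E →ₗ[ℝ] E) := by rw [hmap]; exact V.starProjection_apply_mem ν
    exact this
  have hpp : ‖p‖ ^ 2 = ⟪ν, p⟫_ℝ := by
    have := Submodule.starProjection_inner_eq_zero (K := V) ν p (V.starProjection_apply_mem ν)
    rw [inner_sub_left, sub_eq_zero] at this
    rw [this, ← hp, real_inner_self_eq_norm_sq]
  have hνt : ⟪ν, t⟫_ℝ = 0 := by
    rw [real_inner_comm]; exact hν t htS
  -- Since `ν` is normal to `S`, only the difference `L t - t` contributes. Thus the component of
  -- `ν` in `V` is at most `2σ‖ν‖`, and the rest of `ν` is controlled by `L ν`.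
  have h1 : ⟪ν, p⟫_ℝ ≤ ‖ν‖ * (σ * ‖t‖) := by
    have : ⟪ν, p⟫_ℝ = ⟪ν, L t - t⟫_ℝ := by rw [inner_sub_right, hνt, sub_zero, ht]
    rw [this]
    exact (real_inner_le_norm _ _).trans (mul_le_mul_of_nonneg_left (hL' t) (norm_nonneg _))
  have h2 : ‖t‖ ≤ 2 * ‖p‖ := by
    have a1 := hL' t
    have a2 := norm_sub_norm_le t (L t)
    rw [norm_sub_rev] at a2
    rw [← ht]
    nlinarith [norm_nonneg t]
  have h3 : ‖p‖ ≤ 2 * σ * ‖ν‖ := by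
    have h4 : ‖p‖ * ‖p‖ ≤ (2 * σ * ‖ν‖) * ‖p‖ := by
      have : ‖ν‖ * (σ * ‖t‖) ≤ ‖ν‖ * (σ * (2 * ‖p‖)) := by gcongr
      nlinarith
    rcases (norm_nonneg p).eq_or_lt with h0 | h0
    · rw [← h0]; positivity
    · exact le_of_mul_le_mul_right h4 h0
  have h5 : ‖Vᗮ.starProjection (L ν - ν)‖ ≤ σ * ‖ν‖ :=
    (Vᗮ.norm_starProjection_apply_le _).trans (hL' ν)
  have h6 : ν = p + Vᗮ.starProjection (L ν) - Vᗮ.starProjection (L ν - ν) := by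
    rw [map_sub, Submodule.starProjection_orthogonal]
    simp only [sub_apply, ContinuousLinearMap.id_apply, hp]
    abel
  have h7 : ‖ν‖ ≤ ‖p‖ + ‖Vᗮ.starProjection (L ν)‖ + ‖Vᗮ.starProjection (L ν - ν)‖ := by
    conv_lhs => rw [h6]
    exact (norm_sub_le _ _).trans (add_le_add_left (norm_add_le _ _) _)
  nlinarith [norm_nonneg ν]

/-- The second fundamental form of a set with an almost flat chart is small. -/
theorem IsAlmostFlatChart.secondFundamentalFormNorm_le {n k : ℕ} {σ ρ : ℝ}
    {x₀ : EuclideanSpace ℝ (Fin n)} {V : Submodule ℝ (EuclideanSpace ℝ (Fin n))}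
    {H : EuclideanSpace ℝ (Fin n) → EuclideanSpace ℝ (Fin n)}
    {M : Set (EuclideanSpace ℝ (Fin n))} (h : IsAlmostFlatChart σ ρ x₀ V H M) (hσ : 0 ≤ σ)
    (hσ' : σ ≤ 1 / 8) (hρ : 0 < ρ) (hV : Module.finrank ℝ V = k)
    {U : Set (EuclideanSpace ℝ (Fin k))}
    {φ : EuclideanSpace ℝ (Fin k) → EuclideanSpace ℝ (Fin n)} (hφ : IsLocalParametrization M U φ)
    {u : EuclideanSpace ℝ (Fin k)} (hu : u ∈ U) (hub : φ u ∈ ball x₀ ρ) :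
    secondFundamentalFormNorm φ u ≤ k * (2 * (σ / ρ)) := by
  set Q := Vᗮ.starProjection with hQ
  have hQV : ∀ v, v ∈ V → Q v = 0 := fun v hv => by
    rw [hQ, Submodule.starProjection_apply_eq_zero_iff]
    exact V.le_orthogonal_orthogonal hv
  have hQ0 : ∀ v, Q v = 0 → v ∈ V := fun v hv => by
    rw [hQ, Submodule.starProjection_apply_eq_zero_iff, Submodule.orthogonal_orthogonal] at hv
    exact hv
  have hφs : ∀ w ∈ U, ContDiffAt ℝ ∞ φ w := fun w hw =>
    hφ.contDiffOn.contDiffAt (hφ.isOpen_source.mem_nhds hw)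
  have hφd : ∀ w ∈ U, HasFDerivAt φ (fderiv ℝ φ w) w := fun w hw =>
    ((hφs w hw).differentiableAt (by simp)).hasFDerivAt
  have hmem : ∀ w ∈ U, φ w ∈ M := by
    obtain ⟨O, -, hO⟩ := hφ.relOpen_image
    intro w hw
    have : φ w ∈ M ∩ O := hO ▸ mem_image_of_mem φ hw
    exact this.1
  have hnear : ∀ᶠ w in 𝓝 u, w ∈ U ∧ φ w ∈ ball x₀ ρ :=
    (show ∀ᶠ w in 𝓝 u, w ∈ U from hφ.isOpen_source.mem_nhds hu).and
      ((hφs u hu).continuousAt.eventually (isOpen_ball.mem_nhds hub))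
  have hzero : ∀ᶠ w in 𝓝 u, Q (H (φ w)) = 0 := by
    filter_upwards [hnear] with w hw
    exact hQV _ ((h.mem_iff _ hw.2).1 (hmem w hw.1))
  have hder : ∀ᶠ w in 𝓝 u, ∀ a : EuclideanSpace ℝ (Fin k),
      Q (fderiv ℝ H (φ w) (fderiv ℝ φ w a)) = 0 := by
    filter_upwards [hnear, hzero.eventually_nhds] with w hw hw0 a
    have h1 : HasFDerivAt (fun w => Q (H (φ w)))
        (Q.comp ((fderiv ℝ H (φ w)).comp (fderiv ℝ φ w))) w :=
      Q.hasFDerivAt.comp w ((h.differentiableAt hw.2).hasFDerivAt.comp w (hφd w hw.1))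
    have h2 : HasFDerivAt (fun w : EuclideanSpace ℝ (Fin k) => Q (H (φ w))) 0 w :=
      (hasFDerivAt_const (𝕜 := ℝ) (0 : EuclideanSpace ℝ (Fin n)) w).congr_of_eventuallyEq hw0
    exact congrArg (fun f : EuclideanSpace ℝ (Fin k) →L[ℝ] EuclideanSpace ℝ (Fin n) => f a)
      (h1.unique h2)
  set t : Fin k → EuclideanSpace ℝ (Fin n) := fun i => coordDeriv φ i u with ht
  set L := fderiv ℝ H (φ u) with hL
  set D := fderiv ℝ (fderiv ℝ H) (φ u) with hD
  set S : Submodule ℝ (EuclideanSpace ℝ (Fin n)) := (fderiv ℝ φ u).range with hS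
  -- Second derivative of `Q (H ∘ φ) = 0`. As `L` maps tangent vectors into `V`, the second
  -- derivatives of `φ` may then be replaced by their normal parts.
  have hsec : ∀ i j, Q (L (coordDeriv (coordDeriv φ j) i u)) = -Q (D (t i) (t j)) := by
    intro i j
    have hc : HasFDerivAt (coordDeriv φ j) (fderiv ℝ (coordDeriv φ j) u) u := by
      have h1 : ContDiffAt ℝ ∞ (fderiv ℝ φ) u := (hφs u hu).fderiv_right (by simp)
      have h2 : DifferentiableAt ℝ (coordDeriv φ j) u :=
        (h1.differentiableAt (by simp)).clm_apply (differentiableAt_const _)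
      exact h2.hasFDerivAt
    have hH : HasFDerivAt (fun w => fderiv ℝ H (φ w)) (D.comp (fderiv ℝ φ u)) u := by
      have h1 : ContDiffAt ℝ ∞ (fderiv ℝ H) (φ u) := (h.contDiffAt hub).fderiv_right (by simp)
      exact (h1.differentiableAt (by simp)).hasFDerivAt.comp u (hφd u hu)
    have h1 := Q.hasFDerivAt.comp u (hH.clm_apply hc)
    have h2 : HasFDerivAt (Q ∘ fun w => fderiv ℝ H (φ w) (coordDeriv φ j w)) 0 u :=
      (hasFDerivAt_const (𝕜 := ℝ) (0 : EuclideanSpace ℝ (Fin n)) u).congr_of_eventuallyEq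
        (by filter_upwards [hder] with w hw using hw _)
    have h3 := congrArg (fun f => f (EuclideanSpace.single i 1)) (h1.unique h2)
    simp only [ContinuousLinearMap.comp_apply, add_apply, ContinuousLinearMap.flip_apply,
      map_add, zero_apply] at h3
    exact eq_neg_of_add_eq_zero_left h3
  have hQS : ∀ s ∈ S, L s ∈ V := by
    rintro _ ⟨a, rfl⟩
    exact hQ0 _ (hder.self_of_nhds a)
  have hinj := hφ.injective_fderiv u hu
  have hfin : Module.finrank ℝ S = Module.finrank ℝ V := by
    rw [hV, hS]
    have := LinearMap.finrank_range_of_inj (f := (fderiv ℝ φ u).toLinearMap) hinj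
    rw [finrank_euclideanSpace_fin] at this
    exact this
  have hli : LinearIndependent ℝ t := by
    have hb := (EuclideanSpace.basisFun (Fin k) ℝ).toBasis.linearIndependent
    have := hb.map' (fderiv ℝ φ u).toLinearMap (LinearMap.ker_eq_bot.2 hinj)
    have ht' : t = (fderiv ℝ φ u).toLinearMap ∘ (EuclideanSpace.basisFun (Fin k) ℝ).toBasis := by
      ext1 i
      simp [ht, coordDeriv]
    rw [ht']
    exact this
  refine sum_inv_gram_le hli (secondFundamentalForm φ u) (c := 2 * (σ / ρ)) (by positivity) ?_
  intro a b
  set ν := ∑ i, ∑ j, (a i * b j) • secondFundamentalForm φ u i j with hν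
  have hνS : ν ∈ Sᗮ := Submodule.sum_mem _ fun i _ => Submodule.sum_mem _ fun j _ =>
    Submodule.smul_mem _ _ (Submodule.starProjection_apply_mem _ _)
  have hQA : ∀ i j, Q (L (secondFundamentalForm φ u i j)) = -Q (D (t i) (t j)) := by
    intro i j
    have hA : secondFundamentalForm φ u i j = coordDeriv (coordDeriv φ j) i u -
        S.starProjection (coordDeriv (coordDeriv φ j) i u) := by
      rw [secondFundamentalForm, Submodule.starProjection_orthogonal]
      rfl
    rw [← hsec i j, hA, map_sub, map_sub, hQV _ (hQS _ (S.starProjection_apply_mem _)), sub_zero]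
  have hQν : Q (L ν) = -Q (D (∑ i, a i • t i) (∑ j, b j • t j)) := by
    simp only [hν, map_sum, map_smul, hQA, sum_apply, smul_apply, smul_neg,
      Finset.sum_neg_distrib, Finset.smul_sum, smul_smul]
    rw [Finset.sum_comm]
    simp only [mul_comm]
  have h1 := norm_le_two_mul_norm_starProjection hσ hσ' (h.norm_fderiv_le _ hub) hQS hfin hνS
  rw [← hQ, hQν, norm_neg] at h1
  have h2 := (Vᗮ.norm_starProjection_apply_le (D (∑ i, a i • t i) (∑ j, b j • t j))).trans
    (h.norm_fderiv₂_le _ hub _ _)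
  rw [← hQ] at h2
  linarith

end Curvature

/-! ### Approximating planes and the distance between their directions -/

section Planes

variable {E : Type*} [NormedAddCommGroup E] [InnerProductSpace ℝ E]

/-- The affine plane `x + V` and the set `X` are `τ`-close to each other in the ball `B(x, r)`. -/
structure IsApproxPlane (X : Set E) (x : E) (V : Submodule ℝ E) (r τ : ℝ) : Prop where
  exists_mem_set : ∀ v ∈ V, ‖v‖ < r → ∃ z ∈ X, ‖x + v - z‖ ≤ τ
  exists_mem_plane : ∀ z ∈ X, ‖z - x‖ < r → ∃ v ∈ V, ‖z - x - v‖ ≤ τ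

/-- At all points and all scales below `R`, the set `X` is close to a `k`-dimensional plane. -/
def IsApproxFlat (k : ℕ) (ε R : ℝ) (X : Set E) : Prop :=
  ∀ x ∈ X, ∀ r : ℝ, 0 < r → r < R →
    ∃ V : Submodule ℝ E, Module.finrank ℝ V = k ∧ IsApproxPlane X x V r (ε * r)

/-- Doubling `ε` makes the Hausdorff bound strict, so that approximating points can be chosen. -/
theorem IsReifenbergFlat.isApproxFlat {n k : ℕ} {ε R : ℝ} {X : Set (EuclideanSpace ℝ (Fin n))}
    (hε : 0 < ε) (h : IsReifenbergFlat k ε R X) : IsApproxFlat k (2 * ε) R X := by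
  intro x hx r hr hrR
  obtain ⟨P, hxP, hk, hd⟩ := h.2.2 x hx r hr hrR
  have hlt : ENNReal.ofReal (ε * r) < ENNReal.ofReal (2 * ε * r) := by
    have : 0 < ε * r := by positivity
    exact (ENNReal.ofReal_lt_ofReal_iff (by nlinarith)).2 (by nlinarith)
  have hd' := hd.trans_lt hlt
  have hnorm : ∀ a b : EuclideanSpace ℝ (Fin n), edist a b < ENNReal.ofReal (2 * ε * r) →
      ‖a - b‖ ≤ 2 * ε * r := by
    intro a b hab
    rw [edist_dist] at hab
    rw [← dist_eq_norm]
    exact ((ENNReal.ofReal_lt_ofReal_iff (by positivity)).1 hab).le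
  refine ⟨P.direction, hk, fun v hv hvr => ?_, fun z hz hzr => ?_⟩
  · have hmem : x + v ∈ P := by
      rw [add_comm]; exact AffineSubspace.vadd_mem_of_mem_direction hv hxP
    have hball : x + v ∈ ball x r ∩ (P : Set (EuclideanSpace ℝ (Fin n))) :=
      ⟨by simpa [dist_eq_norm] using hvr, hmem⟩
    obtain ⟨z, hz, hzd⟩ := Metric.exists_edist_lt_of_hausdorffEDist_lt hball hd'
    exact ⟨z, hz.2, hnorm _ _ hzd⟩
  · rw [Metric.hausdorffEDist_comm] at hd'
    have hball : z ∈ ball x r ∩ X := ⟨by simpa [dist_eq_norm] using hzr, hz⟩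
    obtain ⟨y, hy, hyd⟩ := Metric.exists_edist_lt_of_hausdorffEDist_lt hball hd'
    refine ⟨y - x, AffineSubspace.vsub_mem_direction hy.2 hxP, ?_⟩
    rw [sub_sub_sub_cancel_right]
    exact hnorm _ _ hyd

variable [FiniteDimensional ℝ E]

theorem starProjection_orthogonal_eq_zero_of_mem {V : Submodule ℝ E} {v : E} (hv : v ∈ V) :
    Vᗮ.starProjection v = 0 := by
  rw [Submodule.starProjection_apply_eq_zero_iff]
  exact V.le_orthogonal_orthogonal hv

theorem starProjection_orthogonal_eq_zero_iff {V : Submodule ℝ E} {v : E} :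
    Vᗮ.starProjection v = 0 ↔ v ∈ V := by
  rw [Submodule.starProjection_apply_eq_zero_iff, Submodule.orthogonal_orthogonal]

theorem norm_starProjection_orthogonal_le {V : Submodule ℝ E} {w v : E} (hv : v ∈ V) :
    ‖Vᗮ.starProjection w‖ ≤ ‖w - v‖ := by
  have : Vᗮ.starProjection w = Vᗮ.starProjection (w - v) := by
    rw [map_sub, starProjection_orthogonal_eq_zero_of_mem hv, sub_zero]
  rw [this]
  exact Vᗮ.norm_starProjection_apply_le _

/-- Planes approximating the same set near two nearby points have nearby directions. -/
theorem IsApproxPlane.norm_starProjection_le {X : Set E} {x x' : E} {V V' : Submodule ℝ E}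
    {r τ s : ℝ} (h : IsApproxPlane X x V r τ) (h' : IsApproxPlane X x' V' r τ) (hx : x ∈ X)
    (hs : 0 < s) (hτ : 0 ≤ τ) (hr : ‖x - x'‖ + s + τ < r) {v : E} (hv : v ∈ V) :
    ‖V'ᗮ.starProjection v‖ ≤ 3 * τ / s * ‖v‖ := by
  -- Go from `x + v` to a point of `X`, then to the other plane, and do the same with `x` itself:
  -- three errors `τ`. Homogeneity extends the bound to vectors of any length.
  have key : ∀ v ∈ V, ‖v‖ ≤ s → ‖V'ᗮ.starProjection v‖ ≤ 3 * τ := by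
    intro v hv hvs
    have hx0 := norm_nonneg (x - x')
    obtain ⟨z, hz, hzd⟩ := h.exists_mem_set v hv (by linarith)
    have hz' : ‖z - x'‖ < r := by
      have : z - x' = (x - x') + v - (x + v - z) := by abel
      rw [this]
      have a1 := norm_sub_le ((x - x') + v) (x + v - z)
      have a2 := norm_add_le (x - x') v
      linarith
    obtain ⟨v₁, hv₁, hd₁⟩ := h'.exists_mem_plane z hz hz'
    obtain ⟨v₂, hv₂, hd₂⟩ := h'.exists_mem_plane x hx (by linarith)
    refine (norm_starProjection_orthogonal_le (V'.sub_mem hv₁ hv₂)).trans ?_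
    have : v - (v₁ - v₂) = (x + v - z) + (z - x' - v₁) - (x - x' - v₂) := by abel
    rw [this]
    have a1 := norm_sub_le ((x + v - z) + (z - x' - v₁)) (x - x' - v₂)
    have a2 := norm_add_le (x + v - z) (z - x' - v₁)
    linarith
  rcases eq_or_ne v 0 with rfl | hv0
  · simp
  have hn : 0 < ‖v‖ := norm_pos_iff.2 hv0
  have := key ((s / ‖v‖) • v) (V.smul_mem _ hv) (by
    rw [norm_smul, Real.norm_of_nonneg (by positivity)]; field_simp; rfl)
  rw [map_smul, norm_smul, Real.norm_of_nonneg (by positivity)] at this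
  rw [div_mul_eq_mul_div, le_div_iff₀ hs]
  rw [div_mul_eq_mul_div, div_le_iff₀ hn] at this
  linarith

/-- Split `w` along `V` and its complement. The first part is bounded by `h`; the second is bounded
by `h'` through symmetry of the projection. Both one-sided hypotheses are therefore used. -/
theorem norm_starProjection_orthogonal_sub_le {V V' : Submodule ℝ E} {c : ℝ}
    (h : ∀ v ∈ V, ‖V'ᗮ.starProjection v‖ ≤ c * ‖v‖) (hc : 0 ≤ c)
    (h' : ∀ v ∈ V', ‖Vᗮ.starProjection v‖ ≤ c * ‖v‖) :
    ‖V'ᗮ.starProjection - Vᗮ.starProjection‖ ≤ 2 * c := by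
  refine ContinuousLinearMap.opNorm_le_bound _ (by positivity) fun w => ?_
  have h1 : ‖V'ᗮ.starProjection (V.starProjection w)‖ ≤ c * ‖w‖ :=
    (h _ (V.starProjection_apply_mem w)).trans
      (mul_le_mul_of_nonneg_left (V.norm_starProjection_apply_le w) hc)
  set y := Vᗮ.starProjection w with hy
  set p := V'.starProjection y with hp
  have h2 : ‖p‖ ≤ c * ‖w‖ := by
    have e1 : ‖p‖ ^ 2 = ⟪y, p⟫_ℝ := by
      have := Submodule.starProjection_inner_eq_zero (K := V') y p (V'.starProjection_apply_mem y)
      rw [inner_sub_left, sub_eq_zero] at this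
      rw [this, ← hp, real_inner_self_eq_norm_sq]
    have e2 : ⟪y, p⟫_ℝ = ⟪w, Vᗮ.starProjection p⟫_ℝ :=
      Vᗮ.starProjection_isSymmetric w p
    have e3 : ⟪w, Vᗮ.starProjection p⟫_ℝ ≤ ‖w‖ * (c * ‖p‖) :=
      (real_inner_le_norm _ _).trans (mul_le_mul_of_nonneg_left
        (h' _ (V'.starProjection_apply_mem y)) (norm_nonneg _))
    rcases (norm_nonneg p).eq_or_lt with h0 | h0
    · rw [← h0]; positivity
    · exact le_of_mul_le_mul_right (by nlinarith) h0
  have h3 : (V'ᗮ.starProjection - Vᗮ.starProjection) w =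
      V'ᗮ.starProjection (V.starProjection w) - p := by
    have a1 : V.starProjection w = w - y := by
      rw [hy, Submodule.starProjection_orthogonal]; simp
    have a2 : p = y - V'ᗮ.starProjection y := by
      rw [hp, Submodule.starProjection_orthogonal]; simp
    rw [a1, a2, map_sub, sub_apply, ← hy]
    abel
  rw [h3]
  have := norm_sub_le (V'ᗮ.starProjection (V.starProjection w)) p
  linarith

end Planes

/-! ### Finite nets and bounded overlap -/

section Nets

open scoped NNReal

theorem IsCompact.packingNumber_ne_top {X : Type*} [PseudoMetricSpace X] {A : Set X}
    (hA : IsCompact A) {ε : ℝ≥0} (hε : 0 < ε) : packingNumber ε A ≠ ⊤ := by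
  obtain ⟨t, -, htf, ht⟩ := hA.finite_cover_balls (e := (ε / 2 : ℝ≥0)) (by positivity)
  have hcov : IsCover (ε / 2) A t := by
    intro x hx
    obtain ⟨y, hy, hxy⟩ := mem_iUnion₂.1 (ht hx)
    refine ⟨y, hy, ?_⟩
    change edist x y ≤ _
    rw [edist_nndist]
    exact_mod_cast (mem_ball.1 hxy).le
  have h1 := packingNumber_two_mul_le_externalCoveringNumber (ε / 2) A
  rw [mul_div_cancel₀ _ (two_ne_zero)] at h1
  exact ne_top_of_le_ne_top htf.encard_lt_top.ne
    (h1.trans hcov.externalCoveringNumber_le_encard)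

/-- A compact set has a finite net. -/
theorem IsCompact.exists_finset_net {X : Type*} [MetricSpace X] {A : Set X} (hA : IsCompact A)
    {ρ : ℝ} (hρ : 0 < ρ) : ∃ Y : Finset X, (Y : Set X) ⊆ A ∧
      (∀ x ∈ Y, ∀ y ∈ Y, x ≠ y → ρ < dist x y) ∧ ∀ x ∈ A, ∃ y ∈ Y, dist x y ≤ ρ := by
  lift ρ to ℝ≥0 using hρ.le
  have hp := hA.packingNumber_ne_top (ε := ρ) (by exact_mod_cast hρ)
  have hfin : (maximalSeparatedSet ρ A).Finite := by
    rw [← Set.encard_ne_top_iff, encard_maximalSeparatedSet hp]; exact hp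
  refine ⟨hfin.toFinset, ?_, ?_, ?_⟩
  · simpa using maximalSeparatedSet_subset
  · intro x hx y hy hxy
    have : (ρ : ENNReal) < edist x y :=
      isSeparated_maximalSeparatedSet (hfin.mem_toFinset.1 hx) (hfin.mem_toFinset.1 hy) hxy
    rw [edist_nndist] at this
    exact_mod_cast this
  · intro x hx
    obtain ⟨y, hy, hxy⟩ := isCover_maximalSeparatedSet hp hx
    refine ⟨y, hfin.mem_toFinset.2 hy, ?_⟩
    change edist x y ≤ _ at hxy
    rw [edist_nndist] at hxy
    exact_mod_cast hxy

/-- Bounded overlap: a separated set in a ball has a bounded number of elements. -/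
theorem exists_card_le_of_separated (E : Type*) [NormedAddCommGroup E] [NormedSpace ℝ E]
    [FiniteDimensional ℝ E] (r : ℝ) : ∃ N : ℕ, ∀ (ρ : ℝ) (a : E) (s : Finset E), 0 < ρ →
      (∀ x ∈ s, ‖x - a‖ ≤ r * ρ) → (∀ x ∈ s, ∀ y ∈ s, x ≠ y → ρ < dist x y) → s.card ≤ N := by
  classical
  have : ProperSpace E := FiniteDimensional.proper_real E
  have hp := (isCompact_closedBall (0 : E) r).packingNumber_ne_top (ε := 1) one_pos
  refine ⟨(packingNumber 1 (closedBall (0 : E) r)).toNat, fun ρ a s hρ hs hsep => ?_⟩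
  let f : E → E := fun x => ρ⁻¹ • (x - a)
  have hf : Function.Injective f := fun x y hxy => by
    have := smul_right_injective E (inv_ne_zero hρ.ne') hxy
    exact sub_left_injective this
  have hdist : ∀ x y, dist (f x) (f y) = ρ⁻¹ * dist x y := fun x y => by
    simp only [f, dist_smul₀, dist_sub_right, Real.norm_eq_abs, abs_of_pos (inv_pos.2 hρ)]
  have hsub : ((s.image f : Finset E) : Set E) ⊆ closedBall 0 r := by
    intro z hz
    obtain ⟨x, hx, rfl⟩ := Finset.mem_image.1 hz
    rw [mem_closedBall_zero_iff, norm_smul, Real.norm_eq_abs, abs_of_pos (inv_pos.2 hρ)]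
    rw [inv_mul_le_iff₀ hρ]
    linarith [hs x hx]
  have hsep' : IsSeparated ((1 : ℝ≥0) : ENNReal) ((s.image f : Finset E) : Set E) := by
    intro z hz w hw hzw
    obtain ⟨x, hx, rfl⟩ := Finset.mem_image.1 hz
    obtain ⟨y, hy, rfl⟩ := Finset.mem_image.1 hw
    have h1 : 1 < dist (f x) (f y) := by
      rw [hdist, lt_inv_mul_iff₀ hρ, mul_one]
      exact hsep x hx y hy fun h => hzw (by rw [h])
    change _ < edist (f x) (f y)
    rw [edist_nndist]
    exact_mod_cast h1
  have h1 := hsep'.encard_le_packingNumber hsub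
  rw [Set.encard_coe_eq_coe_finsetCard, Finset.card_image_of_injective _ hf] at h1
  rw [← ENat.natCast_toNat hp] at h1
  exact_mod_cast h1

end Nets

/-! ### Rescaling a perturbation of the identity to a chart -/

section Perturbation

variable {E : Type*} [NormedAddCommGroup E] [InnerProductSpace ℝ E]

/-- A `C²`-small perturbation of the identity on the unit ball, transplanted to the ball
`B(x₀, ρ)`, is an almost flat chart. -/
theorem isAlmostFlatChart_of_perturbation {σ ρ : ℝ} (hρ : 0 < ρ) {f : E → E}
    (hf : ContDiffOn ℝ ∞ f (ball 0 1)) (h0 : ∀ x ∈ ball (0 : E) 1, ‖f x‖ ≤ σ)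
    (h1 : ∀ x ∈ ball (0 : E) 1, ‖fderiv ℝ f x‖ ≤ σ)
    (h2 : ∀ x ∈ ball (0 : E) 1, ‖fderiv ℝ (fderiv ℝ f) x‖ ≤ σ) {x₀ : E} {V : Submodule ℝ E}
    {M : Set E} (hM : ∀ z ∈ ball x₀ ρ,
      (z ∈ M ↔ (z - x₀) + ρ • f (ρ⁻¹ • (z - x₀)) ∈ V)) :
    IsAlmostFlatChart σ ρ x₀ V (fun z => (z - x₀) + ρ • f (ρ⁻¹ • (z - x₀))) M := by
  let A : E → E := fun z => ρ⁻¹ • (z - x₀)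
  have hAc : ContDiff ℝ ∞ A := by fun_prop
  have hAd : ∀ z, HasFDerivAt A (ρ⁻¹ • ContinuousLinearMap.id ℝ E) z := fun z =>
    ((hasFDerivAt_id z).sub_const x₀).const_smul ρ⁻¹
  have hAb : ∀ z ∈ ball x₀ ρ, A z ∈ ball (0 : E) 1 := by
    intro z hz
    rw [mem_ball, dist_eq_norm] at hz
    rw [mem_ball_zero_iff, norm_smul, Real.norm_eq_abs, abs_of_pos (inv_pos.2 hρ),
      inv_mul_lt_iff₀ hρ, mul_one]
    exact hz
  have hfc : ∀ x ∈ ball (0 : E) 1, ContDiffAt ℝ ∞ f x := fun x hx =>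
    hf.contDiffAt (isOpen_ball.mem_nhds hx)
  have hd : ∀ z ∈ ball x₀ ρ, fderiv ℝ (fun z => (z - x₀) + ρ • f (A z)) z =
      ContinuousLinearMap.id ℝ E + fderiv ℝ f (A z) := by
    intro z hz
    have a1 := (((hfc _ (hAb z hz)).differentiableAt (by simp)).hasFDerivAt.comp z
      (hAd z)).const_smul ρ
    have a2 := ((hasFDerivAt_id z).sub_const x₀).add a1
    refine HasFDerivAt.fderiv (a2.congr_fderiv ?_)
    ext v
    simp [smul_smul, mul_inv_cancel₀ hρ.ne']
  refine ⟨?_, ?_, ?_, ?_, hM⟩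
  · have a1 : ContDiffOn ℝ ∞ (fun z => f (A z)) (ball x₀ ρ) := hf.comp hAc.contDiffOn hAb
    have a2 : ContDiff ℝ ∞ fun z : E => z - x₀ := by fun_prop
    exact a2.contDiffOn.add (contDiffOn_const.smul a1)
  · intro z hz
    rw [add_sub_cancel_left, norm_smul, Real.norm_of_nonneg hρ.le, mul_comm]
    exact mul_le_mul_of_nonneg_right (h0 _ (hAb z hz)) hρ.le
  · intro z hz
    have := hd z hz
    simp only [A] at this
    rw [this, add_sub_cancel_left]
    exact h1 _ (hAb z hz)
  · intro z hz v w
    have hev : fderiv ℝ (fun z => (z - x₀) + ρ • f (A z)) =ᶠ[𝓝 z] fun z =>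
        ContinuousLinearMap.id ℝ E + fderiv ℝ f (A z) := by
      filter_upwards [isOpen_ball.mem_nhds hz] with z hz using hd z hz
    have a1 : ContDiffAt ℝ ∞ (fderiv ℝ f) (A z) :=
      (hfc _ (hAb z hz)).fderiv_right (by simp)
    have a2 := ((a1.differentiableAt (by simp)).hasFDerivAt.comp z (hAd z)).const_add
      (ContinuousLinearMap.id ℝ E)
    have a3 : fderiv ℝ (fderiv ℝ (fun z => (z - x₀) + ρ • f (ρ⁻¹ • (z - x₀)))) z =
        (fderiv ℝ (fderiv ℝ f) (A z)).comp (ρ⁻¹ • ContinuousLinearMap.id ℝ E) :=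
      hev.fderiv_eq.trans a2.fderiv
    rw [a3]
    simp only [ContinuousLinearMap.comp_apply, smul_apply, ContinuousLinearMap.id_apply, map_smul]
    rw [norm_smul, Real.norm_eq_abs, abs_of_pos (inv_pos.2 hρ)]
    have a4 := (fderiv ℝ (fderiv ℝ f) (A z)).le_of_opNorm₂_le_of_le (h2 _ (hAb z hz))
      (le_refl ‖v‖) (le_refl ‖w‖)
    calc ρ⁻¹ * ‖fderiv ℝ (fderiv ℝ f) (A z) v w‖ ≤ ρ⁻¹ * (σ * ‖v‖ * ‖w‖) := by gcongr
      _ = σ / ρ * ‖v‖ * ‖w‖ := by ring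

end Perturbation

/-! ### Construction of the approximating set -/

section Field

variable {E : Type*} [NormedAddCommGroup E] [InnerProductSpace ℝ E] [FiniteDimensional ℝ E]

/-- Reindexing of a weighted sum, where terms outside of the support of the cutoff are dropped. -/
theorem weightedSum_eq_of_injective {ι κ F : Type*} [Fintype ι] [Fintype κ] [AddCommGroup F]
    [Module ℝ F] (s : Finset ι) {e : s → κ} (he : Function.Injective e) {c : ι → ℝ} {y : ι → E}
    {g : ι → F} {c' : κ → ℝ} {y' : κ → E} {g' : κ → F} {x : E}
    (hs : ∀ i ∉ s, 8 ≤ ‖x - y i‖) (hc : ∀ i, c' (e i) = c i) (hy : ∀ i, y' (e i) = y i)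
    (hg : ∀ i, g' (e i) = g i) (h0 : ∀ j ∉ range e, c' j = 0) :
    weightedSum c y g x = weightedSum c' y' g' x := by
  have h1 : ∑ i : s, (c i * cutoff E (x - y i)) • g i = weightedSum c y g x :=
    Fintype.sum_of_injective Subtype.val Subtype.val_injective _ _ (fun i hi => by
      rw [cutoff_eq_zero (hs i (by simpa using hi)), mul_zero, zero_smul]) fun i => rfl
  have h2 : ∑ i : s, (c i * cutoff E (x - y i)) • g i = weightedSum c' y' g' x :=
    Fintype.sum_of_injective e he _ _ (fun j hj => by rw [h0 j hj, zero_mul, zero_smul])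
      fun i => by rw [hc, hy, hg]
  rw [← h1, h2]

/-- Near a given point only boundedly many net points matter; this moves the field to a fixed index
type, where the compactness estimate is uniform. -/
theorem normalField_eq_of_injective {ι κ : Type*} [Fintype ι] [Fintype κ]
    (s : Finset ι) {e : s → κ} (he : Function.Injective e) {c : ι → ℝ} {y : ι → E}
    {p : ι → E →L[ℝ] E} {c' : κ → ℝ} {y' : κ → E} {p' : κ → E →L[ℝ] E} {x : E}
    (hs : ∀ i ∉ s, 8 ≤ ‖x - y i‖) (hc : ∀ i, c' (e i) = c i) (hy : ∀ i, y' (e i) = y i)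
    (hp : ∀ i, p' (e i) = p i) (h0 : ∀ j ∉ range e, c' j = 0) :
    normalField c y p x = normalField c' y' p' x := by
  have h1 : totalWeight c y x = totalWeight c' y' x :=
    weightedSum_eq_of_injective s he hs hc hy (fun _ => rfl) h0
  have h2 : weightedSum c y p x = weightedSum c' y' p' x :=
    weightedSum_eq_of_injective s he hs hc hy hp h0
  have h3 : weightedSum c y (fun i => p i (x - y i)) x =
      weightedSum c' y' (fun i => p' i (x - y' i)) x :=
    weightedSum_eq_of_injective s he hs hc hy (fun i => by simp only [hp, hy]) h0
  rw [normalField, normalField, averageOperator, averageOperator, averageOffset, averageOffset,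
    h1, h2, h3]

open Classical in
/-- A set which is sufficiently flat at scales up to `40 ρ` is close, at scale `ρ`, to a set with
almost flat charts. -/
theorem exists_almostFlatCharts (E : Type*) [NormedAddCommGroup E] [InnerProductSpace ℝ E]
    [FiniteDimensional ℝ E] {σ : ℝ} (hσ : 0 < σ) :
    ∃ ε : ℝ, 0 < ε ∧ ∀ (k : ℕ) (ε' R ρ : ℝ) (X : Set E), 0 < ε' → ε' ≤ ε → 0 < ρ → 40 * ρ < R →
      IsCompact X → IsApproxFlat k ε' R X →
      ∃ M : Set E, (∀ x ∈ X, ∃ (V : Submodule ℝ E) (H : E → E), Module.finrank ℝ V = k ∧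
        IsApproxPlane X x V (40 * ρ) (σ * ρ) ∧ IsAlmostFlatChart σ ρ x V H M) ∧
        ∀ z ∈ M, ∃ x ∈ X, z ∈ ball x ρ := by
  -- In units of `ρ`, a cutoff of radius `8` met by a point of the unit ball has its centre within
  -- `9`.
  obtain ⟨N, hN⟩ := exists_card_le_of_separated E 9
  obtain ⟨η, hη, hη1, hflat⟩ := exists_almost_flat (Fin N) E hσ
  refine ⟨min σ η / 40, by positivity, fun k ε R ρ X hε hεη hρ hR hX hXf => ?_⟩
  have hεσ : 40 * ε ≤ σ := by have := min_le_left σ η; linarith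
  have hεη' : 40 * ε ≤ η := by have := min_le_right σ η; linarith
  choose! V hVk hV using fun x hx => hXf x hx (40 * ρ) (by positivity) hR
  obtain ⟨Y, hYX, hYsep, hYcov⟩ := hX.exists_finset_net hρ
  let G : E → E := fun z => normalField (fun _ : Y => (1 : ℝ)) (fun y => ρ⁻¹ • (y : E))
    (fun y => (V y)ᗮ.starProjection) (ρ⁻¹ • z)
  -- The scale `40ρ` accommodates distance `9ρ`, test vectors of length `20ρ` and an error below
  -- `11ρ`.
  have hclose : ∀ x ∈ X, ∀ x' ∈ X, ‖x - x'‖ ≤ 9 * ρ →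
      ‖(V x)ᗮ.starProjection - (V x')ᗮ.starProjection‖ ≤ η := by
    intro x hx x' hx' hd
    have hτ : ε * (40 * ρ) < 11 * ρ := by nlinarith
    have e1 := fun v hv => (hV x hx).norm_starProjection_le (hV x' hx') hx (s := 20 * ρ)
      (by positivity) (by positivity) (by linarith) (v := v) hv
    have e2 := fun v hv => (hV x' hx').norm_starProjection_le (hV x hx) hx' (s := 20 * ρ)
      (by positivity) (by positivity) (by rw [norm_sub_rev]; linarith) (v := v) hv
    have e3 := norm_starProjection_orthogonal_sub_le e2 (by positivity) e1
    have e4 : 2 * (3 * (ε * (40 * ρ)) / (20 * ρ)) = 12 * ε := by field_simp; norm_num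
    rw [e4] at e3
    linarith
  -- Nearness to `X` must be demanded: where all weights vanish, the field is `0` by the convention
  -- for the inverse of zero.
  refine ⟨{z | (∃ x ∈ X, z ∈ ball x ρ) ∧ G z = 0}, fun x₀ hx₀ => ?_, fun z hz => hz.1⟩
  set q := (V x₀)ᗮ.starProjection with hq
  have hqq : q * q = q := (V x₀)ᗮ.isIdempotentElem_starProjection
  let s : Finset Y := Finset.univ.filter fun y => ‖(y : E) - x₀‖ ≤ 9 * ρ
  have hs : ∀ y : Y, y ∈ s ↔ ‖(y : E) - x₀‖ ≤ 9 * ρ := fun y => by simp [s]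
  have hcard : s.card ≤ N := by
    have := hN ρ x₀ (s.map ⟨Subtype.val, Subtype.val_injective⟩) hρ (by
      intro x hx
      obtain ⟨y, hy, rfl⟩ := Finset.mem_map.1 hx
      exact (hs y).1 hy) (by
      intro x hx x' hx'
      obtain ⟨y, hy, rfl⟩ := Finset.mem_map.1 hx
      obtain ⟨y', hy', rfl⟩ := Finset.mem_map.1 hx'
      exact hYsep _ y.2 _ y'.2)
    simpa using this
  obtain ⟨e⟩ : Nonempty (s ↪ Fin N) :=
    Function.Embedding.nonempty_of_card_le (by simpa using hcard)
  -- Unused indices get weight `0`, base point `0` and operator `q`: no contribution, and the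
  -- flatness hypotheses hold for them trivially.
  let c' : Fin N → ℝ := Function.extend e (fun _ => 1) 0
  let y' : Fin N → E := Function.extend e (fun y => ρ⁻¹ • ((y : Y) : E) - ρ⁻¹ • x₀) 0
  let p' : Fin N → E →L[ℝ] E :=
    Function.extend e (fun y => (V (y : Y))ᗮ.starProjection) fun _ => q
  have hc' : ∀ i, c' (e i) = 1 := fun i => e.injective.extend_apply _ _ i
  have hy' : ∀ i : s, y' (e i) = ρ⁻¹ • ((i : Y) : E) - ρ⁻¹ • x₀ :=
    fun i => e.injective.extend_apply _ _ i
  have hp' : ∀ i : s, p' (e i) = (V (i : Y))ᗮ.starProjection :=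
    fun i => e.injective.extend_apply _ _ i
  have hc0 : ∀ j ∉ range e, c' j = 0 := fun j hj => Function.extend_apply' _ _ _ hj
  have hy0 : ∀ j ∉ range e, y' j = 0 := fun j hj => Function.extend_apply' _ _ _ hj
  have hp0 : ∀ j ∉ range e, p' j = q := fun j hj => Function.extend_apply' _ _ _ hj
  have hscale : ∀ a b : E, ‖ρ⁻¹ • a - ρ⁻¹ • b‖ = ‖a - b‖ / ρ := fun a b => by
    rw [← smul_sub, norm_smul, Real.norm_eq_abs, abs_of_pos (inv_pos.2 hρ), div_eq_inv_mul]
  obtain ⟨hsm, hbd⟩ := hflat c' y' p' q (by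
      intro j
      by_cases hj : j ∈ range e
      · obtain ⟨i, rfl⟩ := hj
        simp [hc']
      · simp [hc0 j hj]) (by
      intro j
      by_cases hj : j ∈ range e
      · obtain ⟨i, rfl⟩ := hj
        rw [hy', hscale, div_le_iff₀ hρ]
        exact (hs i).1 i.2
      · simp [hy0 j hj]) (by
      intro j
      by_cases hj : j ∈ range e
      · obtain ⟨i, rfl⟩ := hj
        rw [hp']
        exact hclose _ (hYX (i : Y).2) _ hx₀ ((hs i).1 i.2)
      · simp [hp0 j hj, hη.le]) (by
      intro j
      by_cases hj : j ∈ range e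
      · obtain ⟨i, rfl⟩ := hj
        have h1 : ‖((i : Y) : E) - x₀‖ ≤ 9 * ρ := (hs i).1 i.2
        obtain ⟨v, hv, hvd⟩ := (hV x₀ hx₀).exists_mem_plane _ (hYX (i : Y).2) (by linarith)
        have h2 : ‖q (((i : Y) : E) - x₀)‖ ≤ ε * (40 * ρ) :=
          (norm_starProjection_orthogonal_le hv).trans hvd
        rw [hy', ← smul_sub, map_smul, norm_smul, Real.norm_eq_abs, abs_of_pos (inv_pos.2 hρ),
          inv_mul_le_iff₀ hρ]
        nlinarith
      · simp [hy0 j hj, hη.le]) hqq (Submodule.starProjection_norm_le _) (by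
      obtain ⟨y, hyY, hyd⟩ := hYcov x₀ hx₀
      rw [dist_comm, dist_eq_norm] at hyd
      have hys : (⟨y, hyY⟩ : Y) ∈ s := (hs _).2 (by simp only; linarith)
      refine ⟨e ⟨⟨y, hyY⟩, hys⟩, hc' _, ?_⟩
      rw [hy', hscale, div_le_iff₀ hρ, one_mul]
      exact hyd)
  have hG : ∀ z ∈ ball x₀ ρ, G z = normalField c' y' p' (ρ⁻¹ • (z - x₀)) := by
    intro z hz
    rw [mem_ball, dist_eq_norm] at hz
    have h1 : G z = normalField (fun _ : Y => (1 : ℝ)) (fun y => ρ⁻¹ • (y : E) - ρ⁻¹ • x₀)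
        (fun y => (V y)ᗮ.starProjection) (ρ⁻¹ • (z - x₀)) := by
      rw [smul_sub, normalField_sub_const]
    rw [h1]
    refine normalField_eq_of_injective s e.injective ?_ hc' hy' hp' hc0
    intro y hy
    rw [hs, not_le] at hy
    have h2 : ρ⁻¹ • (z - x₀) - (ρ⁻¹ • (y : E) - ρ⁻¹ • x₀) = ρ⁻¹ • z - ρ⁻¹ • (y : E) := by
      rw [smul_sub]; abel
    rw [h2, hscale, le_div_iff₀ hρ]
    have h3 : (y : E) - x₀ = (z - x₀) - (z - y) := by abel
    rw [h3] at hy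
    have := norm_sub_le (z - x₀) (z - y)
    linarith
  refine ⟨V x₀, _, hVk x₀ hx₀, ?_, isAlmostFlatChart_of_perturbation hρ hsm
    (fun x hx => (hbd x hx).1) (fun x hx => (hbd x hx).2.1) (fun x hx => (hbd x hx).2.2.1) ?_⟩
  · have hle : ε * (40 * ρ) ≤ σ * ρ := by nlinarith
    refine ⟨fun v hv hvr => ?_, fun z hz hzr => ?_⟩
    · obtain ⟨z, hz, hzd⟩ := (hV x₀ hx₀).exists_mem_set v hv hvr
      exact ⟨z, hz, hzd.trans hle⟩
    · obtain ⟨v, hv, hvd⟩ := (hV x₀ hx₀).exists_mem_plane z hz hzr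
      exact ⟨v, hv, hvd.trans hle⟩
  · intro z hz
    have hx1 : ρ⁻¹ • (z - x₀) ∈ ball (0 : E) 1 := by
      rw [mem_ball, dist_eq_norm] at hz
      rwa [mem_ball_zero_iff, norm_smul, Real.norm_eq_abs, abs_of_pos (inv_pos.2 hρ),
        inv_mul_lt_iff₀ hρ, mul_one]
    have hqv : ∀ v, q (q v) = q v := fun v => congrArg (fun f : E →L[ℝ] E => f v) hqq
    -- The normal part of the chart map is the rescaled normal part of the field, so `H z ∈ V` says
    -- that the latter vanishes.
    have h1 : q ((z - x₀) + ρ • q (normalField c' y' p' (ρ⁻¹ • (z - x₀)) - ρ⁻¹ • (z - x₀))) =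
        ρ • q (normalField c' y' p' (ρ⁻¹ • (z - x₀))) := by
      simp only [map_add, map_sub, map_smul, hqv, smul_sub, smul_smul, mul_inv_cancel₀ hρ.ne',
        one_smul]
      abel
    rw [← starProjection_orthogonal_eq_zero_iff, ← hq, h1, smul_eq_zero_iff_right hρ.ne']
    simp only [Set.mem_ofPred_eq, hG z hz]
    exact ⟨fun h => by rw [h.2, map_zero], fun h => ⟨⟨x₀, hx₀, hz⟩, (hbd _ hx1).2.2.2 h⟩⟩

end Field

/-! ### Chains of short steps in a flat set -/

section Chains

variable {E : Type*} [NormedAddCommGroup E]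

/-- A step of length at most `t` between two points of `X ∩ S`. -/
def IsStep (X S : Set E) (t : ℝ) (a b : E) : Prop :=
  a ∈ X ∩ S ∧ b ∈ X ∩ S ∧ dist a b ≤ t

/-- The points `a` and `b` are joined by a chain in `X ∩ S` with steps of length at most `t`. -/
abbrev HasChain (X S : Set E) (t : ℝ) : E → E → Prop :=
  Relation.ReflTransGen (IsStep X S t)

theorem HasChain.mono {X S S' : Set E} {t : ℝ} (hS : S ⊆ S') {a b : E} (h : HasChain X S t a b) :
    HasChain X S' t a b := by
  have hstep : IsStep X S t ≤ IsStep X S' t := fun _ _ h =>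
    ⟨⟨h.1.1, hS h.1.2⟩, ⟨h.2.1.1, hS h.2.1.2⟩, h.2.2⟩
  exact Relation.ReflTransGen.mono hstep _ _ h

theorem reflTransGen_of_sequence {α : Type*} {r : α → α → Prop} {u : ℕ → α} {m : ℕ}
    (h : ∀ i < m, Relation.ReflTransGen r (u i) (u (i + 1))) :
    Relation.ReflTransGen r (u 0) (u m) := by
  induction m with
  | zero => exact .refl
  | succ m ih => exact (ih fun i hi => h i (by omega)).trans (h m (by omega))

variable [InnerProductSpace ℝ E]

/-- Near the segment between two points of `X` there is a sequence in `X` with short steps. -/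
theorem IsApproxPlane.exists_sequence {X : Set E} {a b : E} {V : Submodule ℝ E} {r τ : ℝ}
    (h : IsApproxPlane X a V r τ) (hτ : 0 ≤ τ) (ha : a ∈ X) (hb : b ∈ X)
    (hab : ‖b - a‖ + τ < r) {m : ℕ} (hm : 0 < m) :
    ∃ u : ℕ → E, u 0 = a ∧ u m = b ∧ (∀ i ≤ m, u i ∈ X ∧ ‖u i - a‖ ≤ ‖b - a‖ + 2 * τ) ∧
      ∀ i < m, ‖u (i + 1) - u i‖ ≤ (‖b - a‖ + τ) / m + 2 * τ := by
  obtain ⟨v, hv, hvd⟩ := h.exists_mem_plane b hb (by linarith)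
  have hvn : ‖v‖ ≤ ‖b - a‖ + τ := by
    have := norm_sub_norm_le v (b - a)
    rw [norm_sub_rev v (b - a)] at this
    linarith
  have hm' : (0 : ℝ) < m := by exact_mod_cast hm
  -- Equally spaced points of the segment are moved into `X`, with the two ends prescribed exactly
  -- so that sequences can be concatenated; beyond `m` the value is irrelevant.
  have hex : ∀ i : ℕ, ∃ z, i ≤ m → (z ∈ X ∧ ‖a + ((i : ℝ) / m) • v - z‖ ≤ τ ∧
      (i = 0 → z = a) ∧ (i = m → z = b)) := by
    intro i
    by_cases hi : i ≤ m
    swap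
    · exact ⟨a, fun h => absurd h hi⟩
    rcases eq_or_ne i 0 with rfl | h0
    · exact ⟨a, fun _ => ⟨ha, by simpa using hτ, fun _ => rfl, fun h => absurd h hm.ne⟩⟩
    rcases eq_or_ne i m with rfl | hne
    · refine ⟨b, fun _ => ⟨hb, ?_, fun h => absurd h h0, fun _ => rfl⟩⟩
      rw [div_self hm'.ne', one_smul, norm_sub_rev, ← sub_sub]
      exact hvd
    · have hle : (i : ℝ) / m ≤ 1 := (div_le_one hm').2 (by exact_mod_cast hi)
      have : ‖((i : ℝ) / m) • v‖ < r := by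
        rw [norm_smul, Real.norm_of_nonneg (by positivity)]
        nlinarith [norm_nonneg v]
      obtain ⟨z, hz, hzd⟩ := h.exists_mem_set _ (V.smul_mem _ hv) this
      exact ⟨z, fun _ => ⟨hz, hzd, fun h => absurd h h0, fun h => absurd h hne⟩⟩
  choose u hu using hex
  refine ⟨u, (hu 0 (Nat.zero_le _)).2.2.1 rfl, (hu m le_rfl).2.2.2 rfl, fun i hi => ?_,
    fun i hi => ?_⟩
  · obtain ⟨h1, h2, -⟩ := hu i hi
    refine ⟨h1, ?_⟩
    have hle : (i : ℝ) / m ≤ 1 := (div_le_one hm').2 (by exact_mod_cast hi)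
    have e : u i - a = ((i : ℝ) / m) • v - (a + ((i : ℝ) / m) • v - u i) := by abel
    rw [e]
    have h3 := norm_sub_le (((i : ℝ) / m) • v) (a + ((i : ℝ) / m) • v - u i)
    have h4 : ‖((i : ℝ) / m) • v‖ ≤ ‖v‖ := by
      rw [norm_smul, Real.norm_of_nonneg (by positivity)]
      nlinarith [norm_nonneg v]
    linarith
  · obtain ⟨-, h1, -⟩ := hu i hi.le
    obtain ⟨-, h2, -⟩ := hu (i + 1) hi
    have e : u (i + 1) - u i = (m : ℝ)⁻¹ • v - (a + (((i + 1 : ℕ) : ℝ) / m) • v - u (i + 1)) +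
        (a + ((i : ℝ) / m) • v - u i) := by
      push_cast
      module
    rw [e]
    have h3 := norm_add_le ((m : ℝ)⁻¹ • v - (a + (((i + 1 : ℕ) : ℝ) / m) • v - u (i + 1)))
      (a + ((i : ℝ) / m) • v - u i)
    have h4 := norm_sub_le ((m : ℝ)⁻¹ • v) (a + (((i + 1 : ℕ) : ℝ) / m) • v - u (i + 1))
    have h5 : ‖(m : ℝ)⁻¹ • v‖ ≤ (‖b - a‖ + τ) / m := by
      rw [norm_smul, Real.norm_of_nonneg (by positivity), inv_mul_eq_div]
      gcongr
    linarith

/-- Nearby points of a flat set are joined by chains with arbitrarily short steps, which stay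
close to them. -/
theorem IsApproxFlat.hasChain_of_dist_le {X : Set E} {k : ℕ} {ε R t : ℝ}
    (h : IsApproxFlat k ε R X) (hε : 0 < ε) (hε' : ε ≤ 1 / 100) (j : ℕ) :
    ∀ (T : ℝ) (a b : E), 0 < T → T ≤ 10 ^ j * t → 2 * T < R → a ∈ X → b ∈ X → dist a b ≤ T →
      HasChain X (closedBall a (4 * T)) t a b := by
  induction j with
  | zero =>
    intro T a b hT hTt _ ha hb hab
    refine Relation.ReflTransGen.single ⟨⟨ha, mem_closedBall_self (by positivity)⟩, ⟨hb, ?_⟩, ?_⟩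
    · rw [mem_closedBall, dist_comm]; linarith
    · simpa using hab.trans hTt
  | succ j ih =>
    intro T a b hT hTt hTR ha hb hab
    obtain ⟨V, -, hV⟩ := h a ha (2 * T) (by positivity) hTR
    rw [dist_comm, dist_eq_norm] at hab
    have hεT : ε * (2 * T) ≤ T / 50 := by nlinarith
    -- With `20` pieces and error `T/50` each step is below `T/10`, so the induction runs on scales
    -- shrinking by `10`. The excursions stay within `(1 + 1/25 + 4/10) T ≤ 4T`.
    obtain ⟨u, hu0, hum, hu, hstep⟩ := hV.exists_sequence (by positivity) ha hb
      (by linarith) (m := 20) (by norm_num)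
    rw [← hu0, ← hum]
    refine reflTransGen_of_sequence fun i hi => ?_
    have h1 : dist (u i) (u (i + 1)) ≤ T / 10 := by
      rw [dist_comm, dist_eq_norm]
      refine (hstep i hi).trans ?_
      push_cast
      linarith
    refine (ih (T / 10) (u i) (u (i + 1)) (by positivity) ?_ (by linarith) (hu i hi.le).1
      (hu (i + 1) hi).1 h1).mono (closedBall_subset_closedBall' ?_)
    · rw [pow_succ] at hTt; linarith
    · rw [hu0, dist_eq_norm]
      linarith [(hu i hi.le).2]

/-- A point of a flat set in a slightly smaller ball is joined to the centre of the ball by a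
chain in the ball. -/
theorem IsApproxFlat.hasChain {X : Set E} {k : ℕ} {ε R t δ s : ℝ} (h : IsApproxFlat k ε R X)
    (hε : 0 < ε) (hδ1 : δ ≤ 1) (hεδ : ε ≤ δ / 100) (ht : 0 < t) (hs : 0 < s)
    (hsR : s < R) {x p : E} (hx : x ∈ X) (hp : p ∈ X) (hxp : dist p x < (1 - δ / 2) * s) :
    HasChain X (closedBall x ((1 - δ / 4) * s)) t x p := by
  have hδ : 0 < δ := by linarith
  obtain ⟨V, -, hV⟩ := h x hx s hs hsR
  rw [dist_eq_norm] at hxp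
  have hεs : ε * s ≤ δ * s / 100 := by nlinarith
  have hδs : 0 < δ * s := by positivity
  have hδs1 : δ * s ≤ s := by nlinarith
  -- Steps of length `δs/25` deviate by at most `4δs/25` after refinement, which keeps the whole
  -- chain in the ball of radius `(1 - δ/4) s`.
  obtain ⟨m, hm⟩ := exists_nat_gt (64 / δ)
  have hm0 : (0 : ℝ) < m := lt_trans (by positivity) hm
  obtain ⟨u, hu0, hum, hu, hstep⟩ := hV.exists_sequence (by positivity) hx hp
    (by linarith) (m := m) (by exact_mod_cast hm0)
  rw [← hu0, ← hum]
  refine reflTransGen_of_sequence fun i hi => ?_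
  have hsm : s / m ≤ δ * s / 64 := by
    rw [div_le_iff₀ hm0]
    rw [div_lt_iff₀ hδ] at hm
    nlinarith
  have h1 : dist (u i) (u (i + 1)) ≤ δ * s / 25 := by
    rw [dist_comm, dist_eq_norm]
    refine (hstep i hi).trans ?_
    have : (‖p - x‖ + ε * s) / m ≤ s / m := by
      gcongr
      linarith
    linarith
  obtain ⟨j, hj⟩ := pow_unbounded_of_one_lt (δ * s / 25 / t) (by norm_num : (1 : ℝ) < 10)
  rw [div_lt_iff₀ ht] at hj
  refine (h.hasChain_of_dist_le hε (by linarith) j (δ * s / 25) (u i) (u (i + 1)) (by positivity)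
    hj.le (by linarith) (hu i hi.le).1 (hu (i + 1) hi).1 h1).mono
    (closedBall_subset_closedBall' ?_)
  rw [hu0, dist_eq_norm]
  linarith [(hu i hi.le).2]

end Chains

/-! ### From local charts to global properties -/

section Global

variable {E : Type*} [NormedAddCommGroup E] [InnerProductSpace ℝ E]

/-- The set `M` has almost flat charts at scale `ρ` around all points of `X`, and lies near `X`. -/
structure HasAlmostFlatCharts (k : ℕ) (σ ρ : ℝ) (X M : Set E) : Prop where
  exists_chart : ∀ x ∈ X, ∃ (V : Submodule ℝ E) (H : E → E), Module.finrank ℝ V = k ∧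
    IsApproxPlane X x V (40 * ρ) (σ * ρ) ∧ IsAlmostFlatChart σ ρ x V H M
  exists_mem_ball : ∀ z ∈ M, ∃ x ∈ X, z ∈ ball x ρ

namespace HasAlmostFlatCharts

variable {k : ℕ} {σ ρ : ℝ} {X M : Set E}

/-- The point `x + H z` lies on the approximating plane at `x`; it is `σρ`-close both to `z` and to
`X`. -/
theorem exists_dist_le (h : HasAlmostFlatCharts k σ ρ X M) (hσ' : σ ≤ 1 / 16) (hρ : 0 < ρ)
    {z : E} (hz : z ∈ M) : ∃ x ∈ X, dist z x ≤ 2 * (σ * ρ) := by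
  obtain ⟨x, hx, hzx⟩ := h.exists_mem_ball z hz
  obtain ⟨V, H, -, hV, hH⟩ := h.exists_chart x hx
  have h1 := hH.norm_sub_le z hzx
  have hv := (hH.mem_iff z hzx).1 hz
  have h2 := norm_sub_norm_le (H z) (z - x)
  rw [mem_ball, dist_eq_norm] at hzx
  obtain ⟨y, hy, hyd⟩ := hV.exists_mem_set _ hv (by nlinarith)
  refine ⟨y, hy, ?_⟩
  have e : z - y = (x + H z - y) - (H z - (z - x)) := by abel
  rw [dist_eq_norm, e]
  have := _root_.norm_sub_le (x + H z - y) (H z - (z - x))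
  linarith

variable [FiniteDimensional ℝ E]

theorem isCompact (h : HasAlmostFlatCharts k σ ρ X M) (hσ' : σ ≤ 1 / 16)
    (hρ : 0 < ρ) (hX : IsCompact X) : IsCompact M := by
  have : ProperSpace E := FiniteDimensional.proper_real E
  refine isCompact_of_isClosed_isBounded ?_ ?_
  · refine isClosed_of_closure_subset fun z hz => ?_
    -- A limit point of `M` still lies inside a chart ball, because points of `M` are much closer to
    -- `X` than `ρ`. There `M` is the preimage of a closed subspace.
    obtain ⟨w, hw, hzw⟩ := Metric.mem_closure_iff.1 hz (ρ / 4) (by positivity)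
    obtain ⟨x, hx, hwx⟩ := h.exists_dist_le hσ' hρ hw
    obtain ⟨V, H, -, -, hH⟩ := h.exists_chart x hx
    have hzx : z ∈ ball x ρ := by
      rw [mem_ball]
      have := dist_triangle z w x
      nlinarith
    rw [hH.mem_iff z hzx]
    by_contra hV
    have hV' : (V : Set E)ᶜ ∈ 𝓝 (H z) := V.closed_of_finiteDimensional.isOpen_compl.mem_nhds hV
    have ev := (hH.contDiffAt hzx).continuousAt.eventually hV'
    have ev2 : ∀ᶠ y in 𝓝 z, y ∈ ball x ρ := isOpen_ball.mem_nhds hzx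
    obtain ⟨y, hyM, hyV, hyb⟩ :=
      ((mem_closure_iff_frequently.1 hz).and_eventually (ev.and ev2)).exists
    exact hyV ((hH.mem_iff y hyb).1 hyM)
  · refine (hX.isBounded.cthickening (δ := ρ)).subset fun z hz => ?_
    obtain ⟨x, hx, hzx⟩ := h.exists_mem_ball z hz
    exact mem_cthickening_of_dist_le z x ρ X hx hzx.le

theorem hausdorffEDist_le (h : HasAlmostFlatCharts k σ ρ X M) (hσ : 0 ≤ σ) (hσ' : σ ≤ 1 / 16)
    (hρ : 0 < ρ) : Metric.hausdorffEDist X M ≤ ENNReal.ofReal (2 * (σ * ρ)) := by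
  refine Metric.hausdorffEDist_le_of_mem_edist (fun x hx => ?_) fun z hz => ?_
  · obtain ⟨V, H, -, -, hH⟩ := h.exists_chart x hx
    obtain ⟨z, hz, hzd⟩ := hH.exists_mem_dist_le hσ (by linarith) hρ
    refine ⟨z, hz, ?_⟩
    rw [edist_comm, edist_dist]
    exact ENNReal.ofReal_le_ofReal (by nlinarith)
  · obtain ⟨x, hx, hd⟩ := h.exists_dist_le hσ' hρ hz
    refine ⟨x, hx, ?_⟩
    rw [edist_dist]
    exact ENNReal.ofReal_le_ofReal hd

/-- The points of `M` in a slightly smaller ball lie in one component of `M` in the ball. -/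
theorem exists_isConnected (h : HasAlmostFlatCharts k σ ρ X M) (hσ : 0 ≤ σ) (hσ' : σ ≤ 1 / 16)
    (hρ : 0 < ρ) {ε R δ s : ℝ} (hX : IsApproxFlat k ε R X) (hε : 0 < ε) (hδ1 : δ ≤ 1)
    (hεδ : ε ≤ δ / 100) (hs : 0 < s) (hsR : s < R) (hρs : ρ ≤ δ * s / 4) {x : E} (hx : x ∈ X) :
    ∃ G, IsConnected G ∧ G ⊆ M ∩ ball x s ∧ M ∩ ball x ((1 - δ) * s) ⊆ G := by
  have hδ : 0 < δ := by linarith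
  have hδs : 0 < δ * s := by positivity
  have hδs1 : δ * s ≤ s := by nlinarith
  have hC : ∀ x ∈ X, ∃ C, IsConnected C ∧ C ⊆ M ∩ ball x ρ ∧ M ∩ ball x (ρ / 4) ⊆ C := by
    intro x hx
    obtain ⟨V, H, -, -, hH⟩ := h.exists_chart x hx
    exact hH.exists_isConnected hσ (by linarith) hρ
  have hm : ∀ x ∈ X, ∃ z ∈ M, dist z x ≤ σ * ρ := by
    intro x hx
    obtain ⟨V, H, -, -, hH⟩ := h.exists_chart x hx
    exact hH.exists_mem_dist_le hσ (by linarith) hρ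
  choose! C hCc hCsub hCsup using hC
  choose! m hmM hmd using hm
  have hσρ : σ * ρ ≤ ρ / 16 := by nlinarith
  have hCball : ∀ u ∈ X ∩ closedBall x ((1 - δ / 4) * s), C u ⊆ M ∩ ball x s := by
    intro u hu
    refine (hCsub u hu.1).trans (inter_subset_inter_right _ (ball_subset_ball' ?_))
    have := mem_closedBall.1 hu.2
    linarith
  -- Chain steps `ρ/8` and displacement `ρ/16` stay below `ρ/4`: the chart piece at `u` contains a
  -- point of the piece at `w`, so neighbouring pieces share a component.
  have hmC : ∀ u ∈ X, ∀ w ∈ X, dist u w ≤ ρ / 8 → m w ∈ C u := by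
    intro u hu w hw huw
    refine hCsup u hu ⟨hmM w hw, ?_⟩
    rw [mem_ball]
    have := dist_triangle (m w) w u
    rw [dist_comm w u] at this
    linarith [hmd w hw]
  have hself : ∀ u ∈ X, m u ∈ C u := fun u hu =>
    hmC u hu u hu (by rw [dist_self]; positivity)
  have hxx : x ∈ X ∩ closedBall x ((1 - δ / 4) * s) :=
    ⟨hx, mem_closedBall_self (by nlinarith)⟩
  set F := M ∩ ball x s with hF
  have hsubx : C x ⊆ connectedComponentIn F (m x) :=
    (hCc x hx).isPreconnected.subset_connectedComponentIn (hself x hx) (hCball x hxx)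
  have hchain : ∀ p, HasChain X (closedBall x ((1 - δ / 4) * s)) (ρ / 8) x p →
      C p ⊆ connectedComponentIn F (m x) := by
    intro p hp
    induction hp with
    | refl => exact hsubx
    | tail _ hstep ih =>
      obtain ⟨hu, hw, hd⟩ := hstep
      have h1 := ih (hmC _ hu.1 _ hw.1 hd)
      rw [connectedComponentIn_eq h1]
      exact (hCc _ hw.1).isPreconnected.subset_connectedComponentIn (hself _ hw.1)
        (hCball _ hw)
  refine ⟨connectedComponentIn F (m x), ?_, connectedComponentIn_subset _ _, ?_⟩
  · exact isConnected_connectedComponentIn_iff.2 (hCball x hxx (hself x hx))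
  · rintro z ⟨hzM, hz⟩
    rw [mem_ball] at hz
    obtain ⟨p, hp, hzp⟩ := h.exists_dist_le hσ' hρ hzM
    refine hchain p (hX.hasChain hε hδ1 hεδ (by positivity) hs hsR hx hp ?_)
      (hCsup p hp ⟨hzM, ?_⟩)
    · have := dist_triangle p z x
      rw [dist_comm p z] at this
      linarith
    · rw [mem_ball]
      linarith

end HasAlmostFlatCharts

end Global

theorem ConnectedUpToAnnulus.of_exists_isConnected {n : ℕ} {M : Set (EuclideanSpace ℝ (Fin n))}
    {x : EuclideanSpace ℝ (Fin n)} {s ρ ρ' : ℝ}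
    (h : ∃ G, IsConnected G ∧ G ⊆ M ∩ ball x s ∧ M ∩ ball x ρ' ⊆ G) (hρ : ρ ≤ ρ') :
    ConnectedUpToAnnulus M x s ρ := by
  obtain ⟨G, hG, hGs, hGM⟩ := h
  refine ⟨G, (M ∩ ball x s) \ G, (union_sdiff_cancel hGs).symm, hG, fun z hz => ⟨hz.1.2, fun hzρ =>
    hz.2 (hGM ⟨hz.1.1, ball_subset_ball hρ hzρ⟩)⟩⟩

end

/-! ### Choice of constants and conclusion -/

theorem corollary2p5 (n k : ℕ) (δ : ℝ) (hδ : 0 < δ) :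
    ∃ ε : ℝ, 0 < ε ∧
      ∀ (R : ℝ) (X : Set (EuclideanSpace ℝ (Fin n))), 0 < R → IsReifenbergFlat k ε R X →
        ∀ r : ℝ, 0 < r → r < R / 10 →
          ∃ M : Set (EuclideanSpace ℝ (Fin n)),
            IsCompact M ∧ IsSmoothSubmanifold k M ∧
            Metric.hausdorffEDist X M ≤ ENNReal.ofReal (δ * r) ∧
            SecondFundamentalFormBound k M (δ / r) ∧
            (∀ x ∈ X, ConnectedUpToAnnulus M x r ((1 - δ) * r)) ∧
            (∀ x ∈ X, ∀ s : ℝ, r < s → s < R / 10 →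
              ConnectedUpToAnnulus M x s ((1 - 5 * δ) * s)) := by
  obtain ⟨γ, hγ, hγδ, hγ1⟩ : ∃ γ : ℝ, 0 < γ ∧ γ ≤ δ ∧ γ ≤ 1 :=
    ⟨min δ 1, by positivity, min_le_left _ _, min_le_right _ _⟩
  -- With `ρ = γr/40` the curvature bound is `k · 2σ/ρ = k · 80σ/(γr)`, which must be at most `γ/r`.
  obtain ⟨σ, hσ, hσ1, hσk⟩ : ∃ σ : ℝ, 0 < σ ∧ σ ≤ 1 / 16 ∧ k * (80 * σ) ≤ γ * γ := by
    refine ⟨γ * γ / (80 * (k + 1)), by positivity, ?_, ?_⟩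
    · rw [div_le_iff₀ (by positivity)]
      have : (0 : ℝ) ≤ k := by positivity
      nlinarith
    · have : (k : ℝ) * (80 * (γ * γ / (80 * (k + 1)))) = γ * γ * (k / (k + 1)) := by
        field_simp
      rw [this]
      exact mul_le_of_le_one_right (by positivity) ((div_le_one (by positivity)).2 (by linarith))
  obtain ⟨ε, hε, hcharts⟩ := exists_almostFlatCharts (EuclideanSpace ℝ (Fin n)) hσ
  -- The halves compensate for the doubling of `ε` in `IsReifenbergFlat.isApproxFlat`.
  refine ⟨min (ε / 2) (γ / 200), by positivity, fun R X hR hX r hr hrR => ?_⟩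
  set ε' := 2 * min (ε / 2) (γ / 200) with hε'
  have hε'0 : 0 < ε' := by positivity
  have hε'ε : ε' ≤ ε := by have := min_le_left (ε / 2) (γ / 200); linarith
  have hε'γ : ε' ≤ γ / 100 := by have := min_le_right (ε / 2) (γ / 200); linarith
  have hXf : IsApproxFlat k ε' R X := hX.isApproxFlat (by positivity)
  have hγr : γ * r ≤ r := by nlinarith
  have hγr0 : 0 < γ * r := by positivity
  set ρ := γ * r / 40 with hρdef
  have hρ : 0 < ρ := by positivity
  obtain ⟨M, hM1, hM2⟩ := hcharts k ε' R ρ X hε'0 hε'ε hρ (by linarith) hX.1 hXf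
  have hM : HasAlmostFlatCharts k σ ρ X M := ⟨hM1, hM2⟩
  -- One estimate at all scales `s ≥ r` serves both connectedness claims, as `γ ≤ δ ≤ 5δ`.
  have hconn : ∀ x ∈ X, ∀ s, r ≤ s → s < R / 10 →
      ∃ G, IsConnected G ∧ G ⊆ M ∩ Metric.ball x s ∧ M ∩ Metric.ball x ((1 - γ) * s) ⊆ G := by
    intro x hx s hrs hsR
    have : γ * r ≤ γ * s := by gcongr
    exact hM.exists_isConnected hσ.le hσ1 hρ hXf hε'0 hγ1 hε'γ (by linarith) (by linarith)
      (by linarith) hx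
  refine ⟨M, hM.isCompact hσ1 hρ hX.1, ?_, ?_, ?_, ?_, ?_⟩
  · intro p hp
    obtain ⟨x, hx, hpx⟩ := hM2 p hp
    obtain ⟨V, H, hV, -, hH⟩ := hM1 x hx
    exact hH.exists_isLocalParametrization hσ.le (by linarith) hV hp hpx
  · refine (hM.hausdorffEDist_le hσ.le hσ1 hρ).trans (ENNReal.ofReal_le_ofReal ?_)
    have : γ * r ≤ δ * r := by gcongr
    nlinarith
  · intro U φ hφ u hu
    have hmem : φ u ∈ M := by
      obtain ⟨O, -, hO⟩ := hφ.relOpen_image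
      have : φ u ∈ M ∩ O := hO ▸ Set.mem_image_of_mem φ hu
      exact this.1
    obtain ⟨x, hx, hpx⟩ := hM2 _ hmem
    obtain ⟨V, H, hV, -, hH⟩ := hM1 x hx
    refine (hH.secondFundamentalFormNorm_le hσ.le (by linarith) hρ hV hφ hu hpx).trans ?_
    have h1 : (k : ℝ) * (2 * (σ / ρ)) = k * (80 * σ) / (γ * r) := by
      rw [hρdef]; field_simp; ring
    rw [h1, div_le_div_iff₀ hγr0 hr]
    calc k * (80 * σ) * r ≤ γ * γ * r := by gcongr
      _ ≤ δ * (γ * r) := by nlinarith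
  · intro x hx
    exact .of_exists_isConnected (hconn x hx r le_rfl hrR)
      (mul_le_mul_of_nonneg_right (by linarith) hr.le)
  · intro x hx s hrs hsR
    exact .of_exists_isConnected (hconn x hx s hrs.le hsR)
      (mul_le_mul_of_nonneg_right (by linarith) (by linarith))
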